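/- Let $k\ge 1$ and let $D$ be a countable set. A $k$-mode quantum process $\boldsymbol\varrho$ over $D$ is a family of density operators $\rho_{a_1,\dots,a_n}$ on $L^2(\mathbb R^k)^{\otimes n}=L^2((\mathbb R^k)^n)$, one for each finite sequence $(a_1,\dots,a_n)$ of distinct elements of $D$, such that (i) permuting $(a_1,\dots,a_n)$ conjugates the state by the corresponding permutation unitary of the tensor factors, and (ii) the relative trace of $\rho_{a_1,\dots,a_{n+1}}$ over the last factor is $\rho_{a_1,\dots,a_n}$. For $a\in D$ let $(X_{a1},X_{a2},\dots,X_{a\,2k})=(q_{a1},p_{a1},\dots,q_{ak},p_{ak})$ be the position and momentum observables $q_{aj}=x_j$, $p_{aj}=\frac1{\imath}\partial_{x_j}$ of the copy of $L^2(\mathbb R^k)$ at site $a$, on their maximal domains, ampliated to the tensor products containing that copy. Suppose that these observables have finite second moments in the states of $\boldsymbol\varrho$, and let $\mathcal K=[[K(a,b)]]_{a,b\in D}$ be the covariance kernel of $\boldsymbol\varrho$, i.e. $K(a,b)$ is the real $2k\times 2k$ matrix with entries $$K_{rs}(a,b)=\big\langle \tfrac12(X_{ar}X_{bs}+X_{bs}X_{ar})\big\rangle-\langle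 X_{ar}\rangle\langle X_{bs}\rangle ,$$ the expectations being taken in any state of the process in which $a$ and $b$ both occur. Let $(\xi_{a1},\eta_{a1},\dots,\xi_{ak},\eta_{ak})_{a\in D}$ be a real $2k$-variate stochastic process on a probability space $(\Omega,\mathcal F,P)$, with square integrable components of mean zero, and let $\mathcal C=[[C(a,b)]]$ be its covariance kernel, $C(a,b)=\mathbb E\,\gamma_a\gamma_b^{T}$ with $\gamma_a=(\xi_{a1},\eta_{a1},\dots,\xi_{ak},\eta_{ak})^T$. Put $\zeta_{ar}=\xi_{ar}+\imath\eta_{ar}$ and $$U_a(\omega)=\big(W(2^{-1/2}\zeta_{a1}(\omega))\otimes\cdots\otimes W(2^{-1/2}\zeta_{ak}(\omega))\big)^\dagger ,$$ where $W(z)=\exp(z\,\mathsf a^\dagger-\bar z\,\mathsf a)$, $z\in\mathbb C$, $\mathsf a=2^{-1/2}(q+\imath p)$, are the Weyl displacement operators on $L^2(\mathbb R)$. Then the operator-valued functions in $$\sigma_{a_1,\dots,a_n}=\int_\Omega \big(U_{a_1}(\omega)\otimes\cdots\otimes U_{a_n}(\omega)\big)\,\rho_{a_1,\dots,a_n}\,\big(U_{a_1}(\omega)\otimes\cdots\otimes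 U_{a_n}(\omega)\big)^\dagger\,P(d\omega)$$ are Bochner integrable in operator norm, the operators $\sigma_{a_1,\dots,a_n}$ form a $k$-mode quantum process $\boldsymbol\sigma$ over $D$ whose canonical observables have finite second moments, and the covariance kernel of $\boldsymbol\sigma$ is $\mathcal K+\mathcal C$. -/

import Mathlib

open MeasureTheory
open scoped InnerProductSpace

noncomputable section

namespace KMode

/-! ### The Hilbert spaces and elementary tensors -/

/-- The one-site Hilbert space `L²(ℝᵏ)`. -/
abbrev Site (k : ℕ) : Type := Lp ℂ 2 (volume : Measure (Fin k → ℝ))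

/-- The configuration space `(ℝᵏ)ⁿ` of `n` sites with `k` modes each; `x i j` is the `j`-th
coordinate at the `i`-th site. -/
abbrev Config (k n : ℕ) : Type := Fin n → Fin k → ℝ

/-- The `n`-fold Hilbert space tensor product `L²(ℝᵏ) ⊗ ⋯ ⊗ L²(ℝᵏ)`, realised as `L²((ℝᵏ)ⁿ)`;
`u₁ ⊗ ⋯ ⊗ uₙ` is the function `x ↦ u₁ (x 0) ⋯ uₙ (x (n - 1))`. -/
abbrev Hilb (k n : ℕ) : Type := Lp ℂ 2 (volume : Measure (Config k n))

theorem measurePreserving_split (k n : ℕ) :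
    MeasurePreserving (fun x : Config k (n + 1) => (x (Fin.last n), fun i : Fin n => x i.castSucc))
      volume (volume.prod volume) := by
  have h := volume_preserving_piFinSuccAbove (fun _ : Fin (n + 1) => (Fin k → ℝ)) (Fin.last n)
  have e : (fun x : Config k (n + 1) => (x (Fin.last n), fun i : Fin n => x i.castSucc)) =
      MeasurableEquiv.piFinSuccAbove (fun _ : Fin (n + 1) => (Fin k → ℝ)) (Fin.last n) := by
    funext x
    refine Prod.ext rfl ?_
    funext i
    simp [MeasurableEquiv.piFinSuccAbove, Fin.insertNthEquiv, Fin.init]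
  rw [e]
  exact h

theorem memLp_tensor {k n : ℕ} (f : Hilb k n) (g : Site k) :
    MemLp (fun x : Config k (n + 1) => f (fun i => x i.castSucc) * g (x (Fin.last n))) 2 volume := by
  have hf := (Lp.memLp f)
  have hg := (Lp.memLp g)
  have h : MemLp (fun z : (Fin k → ℝ) × Config k n => g z.1 * f z.2) 2 (volume.prod volume) := by
    have hm : AEStronglyMeasurable (fun z : (Fin k → ℝ) × Config k n => g z.1 * f z.2)
        (volume.prod volume) := hg.1.comp_fst.mul hf.1.comp_snd
    rw [memLp_two_iff_integrable_sq_norm hm]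
    have h1 := (memLp_two_iff_integrable_sq_norm hg.1).1 hg
    have h2 := (memLp_two_iff_integrable_sq_norm hf.1).1 hf
    refine (h1.mul_prod h2).congr (Filter.Eventually.of_forall fun z => ?_)
    simp [mul_pow]
  have h' := h.comp_measurePreserving (measurePreserving_split k n)
  refine h'.ae_eq (Filter.Eventually.of_forall fun x => ?_)
  simp [mul_comm]

/-- The elementary tensor `f ⊗ g` of `f ∈ L²((ℝᵏ)ⁿ)` and `g ∈ L²(ℝᵏ)` in `L²((ℝᵏ)ⁿ⁺¹)`. -/
def tensor {k n : ℕ} (f : Hilb k n) (g : Site k) : Hilb k (n + 1) :=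
  (memLp_tensor f g).toLp _

theorem measurePreserving_perm (k : ℕ) {n : ℕ} (π : Equiv.Perm (Fin n)) :
    MeasurePreserving (fun (x : Config k n) (i : Fin n) => x (π.symm i)) volume volume := by
  have h := volume_measurePreserving_piCongrLeft (fun _ : Fin n => (Fin k → ℝ)) π
  have e : (fun (x : Config k n) (i : Fin n) => x (π.symm i)) =
      MeasurableEquiv.piCongrLeft (fun _ : Fin n => (Fin k → ℝ)) π := by
    funext x i
    obtain ⟨j, rfl⟩ := π.surjective i
    simp [MeasurableEquiv.piCongrLeft, Equiv.piCongrLeft_apply_apply]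
  rw [e]
  exact h

/-- The unitary induced by a permutation of the sites, `(U f) (x) = f (x ∘ π⁻¹)`, so that
`U (u₁ ⊗ ⋯ ⊗ uₙ) = u_{π(1)} ⊗ ⋯ ⊗ u_{π(n)}`. -/
def permOp (k : ℕ) {n : ℕ} (π : Equiv.Perm (Fin n)) : Hilb k n →L[ℂ] Hilb k n :=
  (Lp.compMeasurePreservingₗᵢ ℂ _ (measurePreserving_perm k π)).toContinuousLinearMap

/-! ### States and marginals -/

/-- `T` is a density operator: positive, of unit trace. -/
def IsDensity {H : Type} [NormedAddCommGroup H] [InnerProductSpace ℂ H] [CompleteSpace H]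
    (T : H →L[ℂ] H) : Prop :=
  T.IsPositive ∧ ∀ (ι : Type) (e : HilbertBasis ι ℂ H), HasSum (fun i => ⟪e i, T (e i)⟫_ℂ) 1

/-- `S` is the relative trace of `T` over the last tensor factor: `⟨f, S g⟩ = ∑ᵢ ⟨f ⊗ eᵢ, T (g ⊗ eᵢ)⟩`
for every orthonormal basis `e` of that factor. -/
def IsMarginal {k n : ℕ} (T : Hilb k (n + 1) →L[ℂ] Hilb k (n + 1)) (S : Hilb k n →L[ℂ] Hilb k n) :
    Prop :=
  ∀ (f g : Hilb k n) (ι : Type) (e : HilbertBasis ι ℂ (Site k)),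
    HasSum (fun i => ⟪tensor f (e i), T (tensor g (e i))⟫_ℂ) ⟪f, S g⟫_ℂ

/-- A consistent family of states on `L²(ℝᵏ)^{⊗ n}`, one for each finite sequence
`a = (a₁, …, aₙ)` of distinct elements of `D`. -/
structure QuantumProcess (D : Type*) (k : ℕ) where
  state : ∀ {n : ℕ}, (Fin n ↪ D) → (Hilb k n →L[ℂ] Hilb k n)
  isDensity : ∀ {n : ℕ} (a : Fin n ↪ D), IsDensity (state a)
  perm : ∀ {n : ℕ} (a : Fin n ↪ D) (π : Equiv.Perm (Fin n)),
    state (π.toEmbedding.trans a) = permOp k π ∘L state a ∘L permOp k π.symm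
  marginal : ∀ {n : ℕ} (a : Fin (n + 1) ↪ D),
    IsMarginal (state a) (state (Fin.castSuccEmb.trans a))

/-! ### Position and momentum observables -/

theorem locallyIntegrable {k n : ℕ} (f : Hilb k n) :
    LocallyIntegrable (f : Config k n → ℂ) volume :=
  (Lp.memLp f).locallyIntegrable (by norm_num)

theorem integrable_test {k n : ℕ} (f : Hilb k n) {φ : Config k n → ℝ} (hφ : Continuous φ)
    (hs : HasCompactSupport φ) : Integrable (fun x => φ x • f x) volume :=
  (locallyIntegrable f).integrable_smul_left_of_hasCompactSupport hφ hs

/-- The unit vector of `(ℝᵏ)ⁿ` in the direction of the `j`-th coordinate at the `i`-th site. -/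
def dir {k n : ℕ} (i : Fin n) (j : Fin k) : Config k n := Pi.single i (Pi.single j 1)

theorem integrable_fderiv_test {k n : ℕ} (f : Hilb k n) (v : Config k n) {φ : Config k n → ℝ}
    (hφ : ContDiff ℝ (⊤ : ℕ∞) φ) (hs : HasCompactSupport φ) :
    Integrable (fun x => fderiv ℝ φ x v • f x) volume :=
  integrable_test f ((hφ.continuous_fderiv (by simp)).clm_apply continuous_const)
    (hs.fderiv_apply (𝕜 := ℝ) v)

/-- The graph of multiplication by `x i j`. -/
def positionGraph {k n : ℕ} (i : Fin n) (j : Fin k) : Submodule ℂ (Hilb k n × Hilb k n) where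
  carrier := {u | u.2 =ᵐ[volume] fun x => (x i j : ℂ) * u.1 x}
  zero_mem' := by
    change ((0 : Hilb k n) : Config k n → ℂ) =ᵐ[volume] fun x => (x i j : ℂ) * (0 : Hilb k n) x
    filter_upwards [Lp.coeFn_zero ℂ 2 (volume : Measure (Config k n))] with x hx
    simp
  add_mem' := by
    intro u v hu hv
    simp only [Set.mem_ofPred_eq, Prod.fst_add, Prod.snd_add] at *
    filter_upwards [hu, hv, Lp.coeFn_add u.1 v.1, Lp.coeFn_add u.2 v.2] with x h1 h2 h3 h4
    rw [h3, h4, Pi.add_apply, Pi.add_apply, h1, h2]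
    ring
  smul_mem' := by
    intro c u hu
    simp only [Set.mem_ofPred_eq, Prod.smul_fst, Prod.smul_snd] at *
    filter_upwards [hu, Lp.coeFn_smul c u.1, Lp.coeFn_smul c u.2] with x h1 h2 h3
    rw [h2, h3, Pi.smul_apply, Pi.smul_apply, h1]
    simp only [smul_eq_mul]
    ring

/-- The graph of `(1/ı) ∂/∂x_{ij}`, the derivative being taken in the weak sense: `h` is
`(1/ı)` times the weak derivative of `f` iff `ı h` is that weak derivative. -/
def momentumGraph {k n : ℕ} (i : Fin n) (j : Fin k) : Submodule ℂ (Hilb k n × Hilb k n) where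
  carrier := {u | ∀ φ : Config k n → ℝ, ContDiff ℝ (⊤ : ℕ∞) φ → HasCompactSupport φ →
    ∫ x, fderiv ℝ φ x (dir i j) • u.1 x = -∫ x, φ x • (Complex.I * u.2 x)}
  zero_mem' := by
    intro φ _ _
    have h := Lp.coeFn_zero ℂ 2 (volume : Measure (Config k n))
    have h1 : ∫ x, fderiv ℝ φ x (dir i j) • (0 : Hilb k n) x = 0 := by
      apply integral_eq_zero_of_ae
      filter_upwards [h] with x hx
      simp
    have h2 : ∫ x, φ x • (Complex.I * (0 : Hilb k n) x) = 0 := by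
      apply integral_eq_zero_of_ae
      filter_upwards [h] with x hx
      simp
    simp only [Prod.fst_zero, Prod.snd_zero]
    rw [h1, h2, neg_zero]
  add_mem' := by
    intro u v hu hv φ hφ hs
    have h1 : ∫ x, fderiv ℝ φ x (dir i j) • (u.1 + v.1) x =
        ∫ x, (fderiv ℝ φ x (dir i j) • u.1 x + fderiv ℝ φ x (dir i j) • v.1 x) := by
      apply integral_congr_ae
      filter_upwards [Lp.coeFn_add u.1 v.1] with x hx
      rw [hx, Pi.add_apply, smul_add]
    have h2 : ∫ x, φ x • (Complex.I * (u.2 + v.2) x) =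
        ∫ x, (Complex.I * (φ x • u.2 x) + Complex.I * (φ x • v.2 x)) := by
      apply integral_congr_ae
      filter_upwards [Lp.coeFn_add u.2 v.2] with x hx
      rw [hx, Pi.add_apply, mul_add, smul_add, mul_smul_comm, mul_smul_comm]
    have e := hu φ hφ hs
    have e' := hv φ hφ hs
    simp only [← mul_smul_comm] at e e'
    simp only [Prod.fst_add, Prod.snd_add]
    rw [h1, h2, integral_add (integrable_fderiv_test _ _ hφ hs) (integrable_fderiv_test _ _ hφ hs),
      integral_add ((integrable_test _ hφ.continuous hs).const_mul _)
        ((integrable_test _ hφ.continuous hs).const_mul _), e, e', neg_add]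
  smul_mem' := by
    intro c u hu φ hφ hs
    have h1 : ∫ x, fderiv ℝ φ x (dir i j) • (c • u.1) x =
        ∫ x, c * (fderiv ℝ φ x (dir i j) • u.1 x) := by
      apply integral_congr_ae
      filter_upwards [Lp.coeFn_smul c u.1] with x hx
      rw [hx, Pi.smul_apply, smul_eq_mul, mul_smul_comm]
    have h2 : ∫ x, φ x • (Complex.I * (c • u.2) x) =
        ∫ x, c * (φ x • (Complex.I * u.2 x)) := by
      apply integral_congr_ae
      filter_upwards [Lp.coeFn_smul c u.2] with x hx
      rw [hx, Pi.smul_apply, smul_eq_mul, mul_left_comm, mul_smul_comm]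
    simp only [Prod.smul_fst, Prod.smul_snd]
    rw [h1, h2, integral_const_mul, integral_const_mul, hu φ hφ hs, mul_neg]

/-- The position observable at site `i`, mode `j`: multiplication by `x i j` on its maximal
domain in `L²((ℝᵏ)ⁿ)`. -/
def position {k n : ℕ} (i : Fin n) (j : Fin k) : Hilb k n →ₗ.[ℂ] Hilb k n :=
  (positionGraph i j).toLinearPMap

/-- The momentum observable at site `i`, mode `j`: `(1/ı) ∂/∂x_{ij}` on its maximal domain in
`L²((ℝᵏ)ⁿ)`. -/
def momentum {k n : ℕ} (i : Fin n) (j : Fin k) : Hilb k n →ₗ.[ℂ] Hilb k n :=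
  (momentumGraph i j).toLinearPMap

theorem position_graph {k n : ℕ} (i : Fin n) (j : Fin k) :
    (position i j).graph = positionGraph i j := by
  refine Submodule.toLinearPMap_graph_eq _ ?_
  rintro ⟨f, g⟩ h hf
  simp only at hf
  subst hf
  apply Lp.ext
  have h' : g =ᵐ[volume] fun x => (x i j : ℂ) * (0 : Hilb k n) x := h
  filter_upwards [h', Lp.coeFn_zero ℂ 2 (volume : Measure (Config k n))] with x h1 h2
  simp [h1]

theorem momentum_graph {k n : ℕ} (i : Fin n) (j : Fin k) :
    (momentum i j).graph = momentumGraph i j := by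
  refine Submodule.toLinearPMap_graph_eq _ ?_
  rintro ⟨f, g⟩ h hf
  simp only at hf
  subst hf
  have key : ∀ᵐ x ∂(volume : Measure (Config k n)), g x = 0 := by
    apply ae_eq_zero_of_integral_contDiff_smul_eq_zero (locallyIntegrable g)
    intro φ hφ hs
    have h1 := h φ hφ hs
    have h0 : ∫ x, fderiv ℝ φ x (dir i j) • (0 : Hilb k n) x = 0 := by
      apply integral_eq_zero_of_ae
      filter_upwards [Lp.coeFn_zero ℂ 2 (volume : Measure (Config k n))] with x hx
      simp
    simp only [← mul_smul_comm] at h1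
    rw [h0, integral_const_mul] at h1
    simpa using h1.symm
  apply Lp.ext
  filter_upwards [key, Lp.coeFn_zero ℂ 2 (volume : Measure (Config k n))] with x h1 h2
  simp [h1]

/-- Index set of the `2k` canonical observables, in the lexicographic order
`(q₁, p₁, …, q_k, p_k)`: `(j, 0)` stands for `q_j` and `(j, 1)` for `p_j`. -/
abbrev Idx (k : ℕ) : Type := Fin k × Fin 2

/-- The canonical observable with index `r` of the `i`-th site, ampliated to `L²((ℝᵏ)ⁿ)`. -/
def canonicalObs {k n : ℕ} (i : Fin n) (r : Idx k) : Hilb k n →ₗ.[ℂ] Hilb k n :=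
  if r.2 = 0 then position i r.1 else momentum i r.1

/-! ### Expectations and covariances of unbounded observables in a state

For a state `T` and an observable `X`, the second moment of `X` in the state `T` is finite iff
`X √T` is an everywhere defined Hilbert-Schmidt operator, and then `⟨X²⟩ = ‖X √T‖²_HS`. When `X`
and `Y` have finite second moments, `⟨X⟩ = Tr X T = Tr √T X √T` and `⟨½ (X Y + Y X)⟩` is
`½ Tr ((X √T)† (Y √T) + (Y √T)† (X √T))`. -/

section Moments

variable {H : Type} [NormedAddCommGroup H] [InnerProductSpace ℂ H] [CompleteSpace H]

/-- The positive square root of a positive bounded operator. -/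
def root (T : H →L[ℂ] H) : H →L[ℂ] H := CFC.sqrt T

/-- The range of `√T` lies in the domain of `X`, so that `X √T` is everywhere defined. -/
def Applicable (T : H →L[ℂ] H) (X : H →ₗ.[ℂ] H) : Prop := ∀ f : H, root T f ∈ X.domain

/-- The vector `X √T f`. -/
def obsRoot {T : H →L[ℂ] H} {X : H →ₗ.[ℂ] H} (h : Applicable T X) (f : H) : H :=
  X ⟨root T f, h f⟩

/-- `⟨X²⟩ < ∞` in the state `T`: `X √T` is everywhere defined and Hilbert-Schmidt. -/
def HasFiniteSecondMoment (T : H →L[ℂ] H) (X : H →ₗ.[ℂ] H) : Prop :=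
  ∃ h : Applicable T X, ∀ (ι : Type) (e : HilbertBasis ι ℂ H),
    Summable fun i => ‖obsRoot h (e i)‖ ^ 2

/-- `⟨X⟩ = m` in the state `T`. -/
def HasExpectation (T : H →L[ℂ] H) (X : H →ₗ.[ℂ] H) (m : ℝ) : Prop :=
  ∃ h : Applicable T X, ∀ (ι : Type) (e : HilbertBasis ι ℂ H),
    HasSum (fun i => ⟪root T (e i), obsRoot h (e i)⟫_ℂ) (m : ℂ)

/-- `⟨½ (X Y + Y X)⟩ = m` in the state `T`. -/
def HasSymmProductExpectation (T : H →L[ℂ] H) (X Y : H →ₗ.[ℂ] H) (m : ℝ) : Prop :=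
  ∃ (hX : Applicable T X) (hY : Applicable T Y), ∀ (ι : Type) (e : HilbertBasis ι ℂ H),
    HasSum (fun i => (1 / 2 : ℂ) * (⟪obsRoot hX (e i), obsRoot hY (e i)⟫_ℂ +
      ⟪obsRoot hY (e i), obsRoot hX (e i)⟫_ℂ)) (m : ℂ)

/-- `Cov(X, Y) = ⟨½ (X Y + Y X)⟩ - ⟨X⟩ ⟨Y⟩ = c` in the state `T`, all terms being finite. -/
def HasCovariance (T : H →L[ℂ] H) (X Y : H →ₗ.[ℂ] H) (c : ℝ) : Prop :=
  ∃ m mX mY : ℝ, HasSymmProductExpectation T X Y m ∧ HasExpectation T X mX ∧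
    HasExpectation T Y mY ∧ c = m - mX * mY

end Moments

/-- All canonical observables of the process have finite second moments; equivalently, all
polynomials of degree at most `2` in them have finite expectations. -/
def QuantumProcess.FiniteSecondMoments {D : Type*} {k : ℕ} (ρ : QuantumProcess D k) : Prop :=
  ∀ {n : ℕ} (a : Fin n ↪ D) (i : Fin n) (r : Idx k),
    HasFiniteSecondMoment (ρ.state a) (canonicalObs i r)

/-- `K` is the covariance kernel of the process: second moments are finite, and `K(a, b)_{rs}` is
the covariance of `X_{a r}` and `X_{b s}` in every state of the process in which both occur. -/
def QuantumProcess.HasCovarianceKernel {D : Type*} {k : ℕ} (ρ : QuantumProcess D k)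
    (K : D → D → Matrix (Idx k) (Idx k) ℝ) : Prop :=
  ρ.FiniteSecondMoments ∧
    ∀ {n : ℕ} (a : Fin n ↪ D) (i j : Fin n) (r s : Idx k),
      HasCovariance (ρ.state a) (canonicalObs i r) (canonicalObs j s) (K (a i) (a j) r s)

/-! ### Weyl displacement operators -/

/-- The real phase `∑ (√2 Im z_{ij} x_{ij} - Re z_{ij} Im z_{ij})`. -/
def weylPhase {k n : ℕ} (z : Fin n → Fin k → ℂ) (x : Config k n) : ℝ :=
  ∑ i, ∑ j, (√2 * (z i j).im * x i j - (z i j).re * (z i j).im)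

/-- The translation vector `√2 Re z`. -/
def weylShift {k n : ℕ} (z : Fin n → Fin k → ℂ) : Config k n := fun i j => √2 * (z i j).re

theorem norm_exp_phase (t : ℝ) : ‖Complex.exp (Complex.I * (t : ℂ))‖ = 1 := by
  rw [mul_comm, Complex.norm_exp_ofReal_mul_I]

theorem continuous_weylPhase {k n : ℕ} (z : Fin n → Fin k → ℂ) : Continuous (weylPhase z) := by
  unfold weylPhase
  fun_prop

theorem memLp_phase {k n : ℕ} (z : Fin n → Fin k → ℂ) (f : Hilb k n) :
    MemLp (fun x => Complex.exp (Complex.I * (weylPhase z x : ℂ)) * f x) 2 volume := by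
  have hc : Continuous fun x : Config k n => Complex.exp (Complex.I * (weylPhase z x : ℂ)) := by
    have := continuous_weylPhase z
    fun_prop
  refine (Lp.memLp f).of_le (hc.aestronglyMeasurable.mul (Lp.memLp f).1)
    (Filter.Eventually.of_forall fun x => ?_)
  rw [norm_mul, norm_exp_phase, one_mul]

/-- Multiplication by `x ↦ exp (ı weylPhase z x)`. -/
def phaseOp {k n : ℕ} (z : Fin n → Fin k → ℂ) : Hilb k n →ₗᵢ[ℂ] Hilb k n where
  toFun f := (memLp_phase z f).toLp _
  map_add' f g := by
    apply Lp.ext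
    filter_upwards [(memLp_phase z (f + g)).coeFn_toLp, (memLp_phase z f).coeFn_toLp,
      (memLp_phase z g).coeFn_toLp, Lp.coeFn_add f g,
      Lp.coeFn_add ((memLp_phase z f).toLp _) ((memLp_phase z g).toLp _)] with x h1 h2 h3 h4 h5
    rw [h1, h5, Pi.add_apply, h2, h3, h4, Pi.add_apply, mul_add]
  map_smul' c f := by
    apply Lp.ext
    filter_upwards [(memLp_phase z (c • f)).coeFn_toLp, (memLp_phase z f).coeFn_toLp,
      Lp.coeFn_smul c f, Lp.coeFn_smul c ((memLp_phase z f).toLp _)] with x h1 h2 h3 h4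
    rw [h1, RingHom.id_apply, h4, Pi.smul_apply, h2, h3, Pi.smul_apply, smul_eq_mul, smul_eq_mul,
      mul_left_comm]
  norm_map' f := by
    change ‖(memLp_phase z f).toLp _‖ = ‖f‖
    rw [Lp.norm_toLp, Lp.norm_def]
    congr 1
    apply eLpNorm_congr_norm_ae
    refine Filter.Eventually.of_forall fun x => ?_
    rw [norm_mul, norm_exp_phase, one_mul]

/-- The Weyl operator `W(z₁) ⊗ ⋯ ⊗ W(zₙ)` on `L²((ℝᵏ)ⁿ)`, where
`W(z_i) = W(z_{i1}) ⊗ ⋯ ⊗ W(z_{ik})` and `W(ζ) = exp (ζ a† - ζ̄ a)`, `a = 2^{-1/2} (q + ı p)`, on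
`L²(ℝ)`. As `ζ a† - ζ̄ a = ı √2 (Im ζ · q - Re ζ · p)`, the latter is
`(W(ζ) f)(t) = exp (ı (√2 Im ζ · t - Re ζ Im ζ)) f (t - √2 Re ζ)`. -/
def weyl {k n : ℕ} (z : Fin n → Fin k → ℂ) : Hilb k n →L[ℂ] Hilb k n :=
  (phaseOp z).toContinuousLinearMap ∘L
    (Lp.compMeasurePreservingₗᵢ ℂ (fun x : Config k n => x - weylShift z)
      (measurePreserving_sub_right volume (weylShift z))).toContinuousLinearMap

theorem weyl_coeFn {k n : ℕ} (z : Fin n → Fin k → ℂ) (f : Hilb k n) :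
    weyl z f =ᵐ[volume] fun x =>
      Complex.exp (Complex.I * (weylPhase z x : ℂ)) * f (x - weylShift z) := by
  have hp := measurePreserving_sub_right (volume : Measure (Config k n)) (weylShift z)
  have h1 := (memLp_phase z (Lp.compMeasurePreserving _ hp f)).coeFn_toLp
  filter_upwards [h1, Lp.coeFn_compMeasurePreserving f hp] with x h1 h2
  rw [h2] at h1
  exact h1

/-- `W(z₁) ⊗ ⋯ ⊗ W(zₙ₊₁)` acts on elementary tensors factor by factor. -/
theorem weyl_tensor {k n : ℕ} (z : Fin (n + 1) → Fin k → ℂ) (f : Hilb k n) (g g' : Site k)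
    (hg : g' =ᵐ[volume] fun t => Complex.exp (Complex.I * (weylPhase (n := 1)
      (fun _ => z (Fin.last n)) (fun _ => t) : ℂ)) * g (t - fun j => √2 * (z (Fin.last n) j).re)) :
    weyl z (tensor f g) = tensor (weyl (fun i => z i.castSucc) f) g' := by
  have hs := measurePreserving_split k n
  have q1 := (Measure.quasiMeasurePreserving_fst (μ := (volume : Measure (Fin k → ℝ)))
    (ν := (volume : Measure (Config k n)))).comp hs.quasiMeasurePreserving
  have q2 := (Measure.quasiMeasurePreserving_snd (μ := (volume : Measure (Fin k → ℝ)))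
    (ν := (volume : Measure (Config k n)))).comp hs.quasiMeasurePreserving
  have hp := measurePreserving_sub_right (volume : Measure (Config k (n + 1))) (weylShift z)
  apply Lp.ext
  filter_upwards [weyl_coeFn z (tensor f g),
    hp.quasiMeasurePreserving.ae_eq_comp (memLp_tensor f g).coeFn_toLp,
    (memLp_tensor (weyl (fun i => z i.castSucc) f) g').coeFn_toLp,
    q1.ae_eq_comp hg, q2.ae_eq_comp (weyl_coeFn (fun i => z i.castSucc) f)] with x h1 h2 h3 h4 h5
  simp only [Function.comp_apply] at h2 h4 h5
  rw [h1]
  unfold tensor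
  rw [h2, h3, h4, h5]
  have e : weylPhase z x = weylPhase (fun i => z i.castSucc) (fun i => x i.castSucc) +
      weylPhase (n := 1) (fun _ => z (Fin.last n)) (fun _ => x (Fin.last n)) := by
    simp only [weylPhase, Fin.sum_univ_castSucc, Finset.univ_unique, Finset.sum_const,
      Finset.card_singleton, one_smul]
  rw [e, Complex.ofReal_add, mul_add, Complex.exp_add]
  have e1 : (fun i : Fin n => (x - weylShift z) i.castSucc) =
      (fun i => x i.castSucc) - weylShift (fun i => z i.castSucc) := rfl
  have e2 : (x - weylShift z) (Fin.last n) =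
      x (Fin.last n) - fun j => √2 * (z (Fin.last n) j).re := rfl
  rw [e1, e2]
  ring

/-- On differentiable functions the generator of `s ↦ W(s z)` at `s = 0` is
`ı √2 ∑ (Im z_{ij} q_{ij} - Re z_{ij} p_{ij})`, `p_{ij} = -ı ∂_{ij}`, i.e.
`∑ (z_{ij} a_{ij}† - z̄_{ij} a_{ij})`. -/
theorem weyl_generator {k n : ℕ} (z : Fin n → Fin k → ℂ) (f : Config k n → ℂ) (x : Config k n)
    (hf : DifferentiableAt ℝ f x) :
    HasDerivAt (fun s : ℝ => Complex.exp (Complex.I * (weylPhase (fun i j => s * z i j) x : ℂ)) *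
        f (x - weylShift (fun i j => s * z i j)))
      (Complex.I * √2 * ∑ i, ∑ j, ((z i j).im * (x i j * f x) -
        (z i j).re * (-Complex.I * fderiv ℝ f x (dir i j)))) 0 := by
  have hp : HasDerivAt (fun s : ℝ => weylPhase (fun i j => s * z i j) x)
      (∑ i, ∑ j, √2 * (z i j).im * x i j) 0 := by
    have e : (fun s : ℝ => weylPhase (fun i j => s * z i j) x) = fun s =>
        s * (∑ i, ∑ j, √2 * (z i j).im * x i j) - s ^ 2 * ∑ i, ∑ j, (z i j).re * (z i j).im := by
      funext s
      simp only [weylPhase, Complex.re_ofReal_mul, Complex.im_ofReal_mul, Finset.mul_sum,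
        ← Finset.sum_sub_distrib]
      refine Finset.sum_congr rfl fun i _ => Finset.sum_congr rfl fun j _ => ?_
      ring
    rw [e]
    convert! ((hasDerivAt_id (0 : ℝ)).mul_const (∑ i, ∑ j, √2 * (z i j).im * x i j)).sub
      (((hasDerivAt_id (0 : ℝ)).pow 2).mul_const (∑ i, ∑ j, (z i j).re * (z i j).im)) using 1
    simp
  have hsh : ∀ s : ℝ, weylShift (fun i j => (s : ℂ) * z i j) = s • weylShift z := by
    intro s
    funext i j
    simp only [weylShift, Complex.re_ofReal_mul, Pi.smul_apply, smul_eq_mul]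
    ring
  have hdir : weylShift z = ∑ i, ∑ j, (√2 * (z i j).re) • (dir i j : Config k n) := by
    funext a b
    simp [weylShift, dir, Finset.sum_apply, Pi.single_apply, apply_ite, ite_apply]
  have hphase0 : weylPhase (fun i j => ((0 : ℝ) : ℂ) * z i j) x = 0 := by simp [weylPhase]
  have hline : HasDerivAt (fun s : ℝ => x - s • weylShift z) (-weylShift z) 0 := by
    simpa using ((hasDerivAt_id (0 : ℝ)).smul_const (weylShift z)).const_sub x
  have hf' : HasFDerivAt f (fderiv ℝ f x) (x - (0 : ℝ) • weylShift z) := by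
    simpa using hf.hasFDerivAt
  have h := ((hp.ofReal_comp.const_mul Complex.I).cexp).mul (hf'.comp_hasDerivAt 0 hline)
  rw [hphase0] at h
  simp only [hsh]
  convert! h using 1
  simp only [Complex.ofReal_zero, mul_zero, Complex.exp_zero, one_mul, zero_smul, sub_zero,
    map_neg, Function.comp_apply]
  rw [hdir]
  simp only [map_sum, map_smul, Complex.real_smul, Complex.ofReal_sum, Complex.ofReal_mul,
    Finset.mul_sum, Finset.sum_mul, ← Finset.sum_neg_distrib, ← Finset.sum_add_distrib]
  refine Finset.sum_congr rfl fun i _ => Finset.sum_congr rfl fun j _ => ?_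
  linear_combination (√2 * (z i j).re * fderiv ℝ f x (dir i j) : ℂ) * Complex.I_sq

/-! ### Random displacement of a process -/

/-- The displacement amplitudes at the sites `a`: with `ζ_{b j} = ξ_{b j} + ı η_{b j}`, where
`ξ_{b j} = γ_{b,(j,0)}` and `η_{b j} = γ_{b,(j,1)}`, this is `2^{-1/2} ζ_{a_i j}(ω)`. -/
def amplitude {D Ω : Type*} {k n : ℕ} (γ : D → Idx k → Ω → ℝ) (a : Fin n ↪ D) (ω : Ω) :
    Fin n → Fin k → ℂ :=
  fun i j => ((√2)⁻¹ : ℂ) * ((γ (a i) (j, 0) ω : ℂ) + Complex.I * (γ (a i) (j, 1) ω : ℂ))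

/-- `U_{a₁}(ω) ⊗ ⋯ ⊗ U_{aₙ}(ω)` with `U_b(ω) = W(2^{-1/2} ζ_b(ω))†`. -/
def randomUnitary {D Ω : Type*} {k n : ℕ} (γ : D → Idx k → Ω → ℝ) (a : Fin n ↪ D) (ω : Ω) :
    Hilb k n →L[ℂ] Hilb k n :=
  ContinuousLinearMap.adjoint (weyl (amplitude γ a ω))

/-- `(U_{a₁}(ω) ⊗ ⋯ ⊗ U_{aₙ}(ω)) ρ_{a₁,…,aₙ} (U_{a₁}(ω) ⊗ ⋯ ⊗ U_{aₙ}(ω))†`. -/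
def displacedState {D Ω : Type*} {k n : ℕ} (ρ : QuantumProcess D k) (γ : D → Idx k → Ω → ℝ)
    (a : Fin n ↪ D) (ω : Ω) : Hilb k n →L[ℂ] Hilb k n :=
  randomUnitary γ a ω ∘L ρ.state a ∘L ContinuousLinearMap.adjoint (randomUnitary γ a ω)

end KMode

end

noncomputable section

namespace KMode

/-! ### Hilbert-Schmidt operators -/

section HilbertSchmidt

open ContinuousLinearMap Filter Topology

variable {H : Type} [NormedAddCommGroup H] [InnerProductSpace ℂ H] [CompleteSpace H]

/-! Write `W` for the Weyl operator at the random amplitude, so that the mixed state is `σ = ∫ W† ρ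
W`. Conjugation by `W` subtracts from each canonical observable `X` a real scalar: `W X W† = X - c`,
where `c` is the matching component of the classical process. Hence `⟨X Y⟩` in `σ` is the average of
`⟨(X - c)(Y - d)⟩` in `ρ`; since `c` and `d` have mean zero, the linear terms drop out, the means do
not change, and the second moment grows by `E[c d]`.

The work lies in the unboundedness of `X`. Test functions are dense and invariant under `W`, and `X`
is the adjoint of its restriction to them (`isAdjointOf_canonicalObs`). Therefore finiteness of the
second moment in a state `T` means that `√T X`, defined on test functions, extends to a
Hilbert-Schmidt operator, whose adjoint is `X √T`. For `σ` no formula for `√σ` is needed: `⟨√σ X φ,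
√σ Y ψ⟩ = ⟨X φ, σ Y ψ⟩` is an integral of expressions in `ρ` (`inner_root_op`). Summing over an
orthonormal basis `e`, using that `W e` is again a basis, and exchanging sum and integral gives the
moments (`hsPair_mixed`).

Norm measurability of the integrand holds because `W` is strongly continuous in the amplitude and
the Hilbert-Schmidt factor `√ρ` improves this to norm continuity (`IsHS.continuous_comp`). The
marginal condition follows from the factorisation of `W` over sites and dominated convergence. -/

/-- `A` is a Hilbert-Schmidt operator. -/
def IsHS (A : H →L[ℂ] H) : Prop :=
  ∀ (ι : Type) (e : HilbertBasis ι ℂ H), Summable fun i => ‖A (e i)‖ ^ 2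

/-- The Hilbert-Schmidt inner product of `A` and `B` is `c`. -/
def HSPair (A B : H →L[ℂ] H) (c : ℂ) : Prop :=
  ∀ (ι : Type) (e : HilbertBasis ι ℂ H), HasSum (fun i => ⟪A (e i), B (e i)⟫_ℂ) c

theorem hasSum_norm_inner_sq {ι : Type*} (e : HilbertBasis ι ℂ H) (x : H) :
    HasSum (fun i => ‖⟪e i, x⟫_ℂ‖ ^ 2) (‖x‖ ^ 2) := by
  have h := Complex.hasSum_re (e.hasSum_inner_mul_inner x x)
  rw [inner_self_eq_norm_sq_to_K] at h
  convert h using 1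
  · funext i
    rw [← inner_conj_symm x (e i), Complex.conj_mul']
    norm_cast
  · norm_cast

theorem summable_prod_norm_inner_sq {ι κ : Type*} (e : HilbertBasis ι ℂ H) (e' : HilbertBasis κ ℂ H)
    {A : H →L[ℂ] H} (hA : Summable fun i => ‖A (e i)‖ ^ 2) :
    Summable fun p : ι × κ => ‖⟪e' p.2, A (e p.1)⟫_ℂ‖ ^ 2 := by
  rw [summable_prod_of_nonneg fun _ => by positivity]
  refine ⟨fun i => (hasSum_norm_inner_sq e' (A (e i))).summable, ?_⟩
  simpa only [(hasSum_norm_inner_sq e' _).tsum_eq] using hA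

/-- Both sums are iterated sums of one double series, absolutely convergent by Cauchy-Schwarz. Since
the two bases are unrelated, this also yields independence of the basis. -/
theorem exists_hasSum_inner_adjoint {ι κ : Type*} (e : HilbertBasis ι ℂ H)
    (e' : HilbertBasis κ ℂ H) {A B : H →L[ℂ] H} (hA : Summable fun i => ‖A (e i)‖ ^ 2)
    (hB : Summable fun i => ‖B (e i)‖ ^ 2) :
    ∃ c, HasSum (fun i => ⟪A (e i), B (e i)⟫_ℂ) c ∧
      HasSum (fun j => ⟪adjoint B (e' j), adjoint A (e' j)⟫_ℂ) c := by
  have hs : Summable fun p : ι × κ => ⟪A (e p.1), e' p.2⟫_ℂ * ⟪e' p.2, B (e p.1)⟫_ℂ := by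
    refine Summable.of_norm_bounded
      ((summable_prod_norm_inner_sq e e' hA).add (summable_prod_norm_inner_sq e e' hB))
      fun p => ?_
    rw [norm_mul, norm_inner_symm]
    nlinarith [sq_nonneg (‖⟪e' p.2, A (e p.1)⟫_ℂ‖ - ‖⟪e' p.2, B (e p.1)⟫_ℂ‖),
      sq_nonneg ‖⟪e' p.2, A (e p.1)⟫_ℂ‖, sq_nonneg ‖⟪e' p.2, B (e p.1)⟫_ℂ‖]
  obtain ⟨c, hc⟩ := hs
  have hc' : HasSum (fun p : κ × ι => ⟪A (e p.2), e' p.1⟫_ℂ * ⟪e' p.1, B (e p.2)⟫_ℂ) c :=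
    (Equiv.prodComm κ ι).hasSum_iff.2 hc
  have h1 : ∀ i, HasSum (fun j => ⟪A (e i), e' j⟫_ℂ * ⟪e' j, B (e i)⟫_ℂ) ⟪A (e i), B (e i)⟫_ℂ :=
    fun i => e'.hasSum_inner_mul_inner _ _
  have h2 : ∀ j, HasSum (fun i => ⟪A (e i), e' j⟫_ℂ * ⟪e' j, B (e i)⟫_ℂ)
      ⟪adjoint B (e' j), adjoint A (e' j)⟫_ℂ := by
    intro j
    have h := e.hasSum_inner_mul_inner (adjoint B (e' j)) (adjoint A (e' j))
    have h3 : ∀ i, ⟪A (e i), e' j⟫_ℂ * ⟪e' j, B (e i)⟫_ℂ =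
        ⟪adjoint B (e' j), e i⟫_ℂ * ⟪e i, adjoint A (e' j)⟫_ℂ := fun i => by
      rw [adjoint_inner_left, adjoint_inner_right, mul_comm]
    simp only [h3]
    exact h
  exact ⟨c, HasSum.prod_fiberwise hc h1, HasSum.prod_fiberwise hc' h2⟩

theorem IsHS.of_basis {ι : Type*} (e : HilbertBasis ι ℂ H) {A : H →L[ℂ] H}
    (hA : Summable fun i => ‖A (e i)‖ ^ 2) : IsHS (adjoint A) := by
  intro κ e'
  obtain ⟨c, -, hc⟩ := exists_hasSum_inner_adjoint e e' hA hA
  convert (Complex.hasSum_re hc).summable using 2 with j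
  rw [inner_self_eq_norm_sq_to_K]
  norm_cast

theorem IsHS.adjoint {A : H →L[ℂ] H} (hA : IsHS A) : IsHS (adjoint A) := by
  obtain ⟨w, e, -⟩ := exists_hilbertBasis ℂ H
  exact IsHS.of_basis e (hA w e)

/-- Any basis is compared with the fixed `e₀` through the adjoint series, so one value `c` serves
all bases. -/
theorem IsHS.exists_pair {A B : H →L[ℂ] H} (hA : IsHS A) (hB : IsHS B) :
    ∃ c, HSPair A B c ∧ HSPair (ContinuousLinearMap.adjoint B) (ContinuousLinearMap.adjoint A) c := by
  obtain ⟨w, e₀, -⟩ := exists_hilbertBasis ℂ H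
  obtain ⟨c, hc, hc'⟩ := exists_hasSum_inner_adjoint e₀ e₀ (hA w e₀) (hB w e₀)
  refine ⟨c, fun ι e => ?_, fun ι e => ?_⟩
  · obtain ⟨d, hd, hd'⟩ := exists_hasSum_inner_adjoint e e₀ (hA ι e) (hB ι e)
    rwa [hc'.unique hd']
  · obtain ⟨d, hd, hd'⟩ := exists_hasSum_inner_adjoint e₀ e (hA w e₀) (hB w e₀)
    rwa [hc.unique hd]

theorem HSPair.adjoint {A B : H →L[ℂ] H} {c : ℂ} (h : HSPair A B c) (hA : IsHS A) (hB : IsHS B) :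
    HSPair (ContinuousLinearMap.adjoint B) (ContinuousLinearMap.adjoint A) c := by
  obtain ⟨d, hd, hd'⟩ := hA.exists_pair hB
  obtain ⟨w, e₀, -⟩ := exists_hilbertBasis ℂ H
  rwa [(h w e₀).unique (hd w e₀)]

theorem HSPair.symm {A B : H →L[ℂ] H} {c : ℂ} (h : HSPair A B c) :
    HSPair B A (starRingEnd ℂ c) := by
  intro ι e
  have := (h ι e).map (starRingEnd ℂ) Complex.continuous_conj
  convert this using 2 with i
  simp

theorem HSPair.isHS {A : H →L[ℂ] H} {c : ℂ} (h : HSPair A A c) : IsHS A := by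
  intro ι e
  convert (Complex.hasSum_re (h ι e)).summable using 2 with i
  rw [inner_self_eq_norm_sq_to_K]
  norm_cast

/-- Transport of a Hilbert basis by a unitary. -/
def mapBasis {ι : Type*} (e : HilbertBasis ι ℂ H) (W : H ≃ₗᵢ[ℂ] H) : HilbertBasis ι ℂ H :=
  HilbertBasis.ofRepr (W.symm.trans e.repr)

theorem mapBasis_apply {ι : Type*} (e : HilbertBasis ι ℂ H) (W : H ≃ₗᵢ[ℂ] H) (i : ι) :
    mapBasis e W i = W (e i) := by
  classical
  rw [← HilbertBasis.repr_symm_single, ← HilbertBasis.repr_symm_single]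
  rfl

/-- The estimate is made on the adjoint, where Parseval expands `‖A† g‖²` in the numbers `⟪A (e i),
g⟫`. -/
theorem norm_sq_le_of_hasSum {ι : Type*} (e : HilbertBasis ι ℂ H) {A : H →L[ℂ] H} {S : ℝ}
    (hS : HasSum (fun i => ‖A (e i)‖ ^ 2) S) : ‖A‖ ^ 2 ≤ S := by
  have hS0 : 0 ≤ S := hS.nonneg fun i => by positivity
  have h : ‖ContinuousLinearMap.adjoint A‖ ≤ √S := by
    refine ContinuousLinearMap.opNorm_le_bound _ (Real.sqrt_nonneg _) fun g => ?_
    have h1 := hasSum_norm_inner_sq e (ContinuousLinearMap.adjoint A g)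
    have h2 : ‖ContinuousLinearMap.adjoint A g‖ ^ 2 ≤ S * ‖g‖ ^ 2 := by
      refine hasSum_le (fun i => ?_) h1 (hS.mul_right (‖g‖ ^ 2))
      rw [adjoint_inner_right, ← mul_pow]
      gcongr
      exact norm_inner_le_norm _ _
    refine Real.le_sqrt_of_sq_le h2 |>.trans ?_
    rw [Real.sqrt_mul hS0, Real.sqrt_sq (norm_nonneg _)]
  rw [LinearIsometryEquiv.norm_map] at h
  calc ‖A‖ ^ 2 ≤ √S ^ 2 := by gcongr
    _ = S := Real.sq_sqrt hS0

/-- The Hilbert-Schmidt norm dominates the operator norm, and its defining series tends to zero by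
dominated convergence: each term does so by strong continuity, and `4 * ‖A (e i)‖ ^ 2` is a summable
majorant. -/
theorem IsHS.continuous_comp {Z : Type*} [TopologicalSpace Z] {A : H →L[ℂ] H} (hA : IsHS A)
    {V : Z → H →L[ℂ] H} (hV : ∀ z f, ‖V z f‖ = ‖f‖) (hc : ∀ f, Continuous fun z => V z f) :
    Continuous fun z => V z ∘L A := by
  obtain ⟨w, e, -⟩ := exists_hilbertBasis ℂ H
  rw [continuous_iff_continuousAt]
  intro z₀
  have hb : ∀ z i, ‖(V z ∘L A - V z₀ ∘L A) (e i)‖ ^ 2 ≤ 4 * ‖A (e i)‖ ^ 2 := by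
    intro z i
    have h : ‖(V z ∘L A - V z₀ ∘L A) (e i)‖ ≤ 2 * ‖A (e i)‖ := by
      refine (norm_sub_le (V z (A (e i))) (V z₀ (A (e i)))).trans_eq ?_
      rw [hV, hV]
      ring
    calc _ ≤ (2 * ‖A (e i)‖) ^ 2 := by gcongr
      _ = _ := by ring
  have hs : Summable fun i => 4 * ‖A (e i)‖ ^ 2 := (hA w e).mul_left 4
  have key : Tendsto (fun z => ∑' i, ‖(V z ∘L A - V z₀ ∘L A) (e i)‖ ^ 2) (𝓝 z₀)
      (𝓝 (∑' i : w, (0 : ℝ))) := by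
    refine tendsto_tsum_of_dominated_convergence hs (fun i => ?_)
      (Eventually.of_forall fun z i => ?_)
    · have : Continuous fun z => ‖(V z ∘L A - V z₀ ∘L A) (e i)‖ ^ 2 :=
        (((hc (A (e i))).sub continuous_const).norm.pow 2)
      simpa using this.tendsto z₀
    · rw [Real.norm_of_nonneg (by positivity)]
      exact hb z i
  rw [tsum_zero] at key
  have hn : Tendsto (fun z => ‖V z ∘L A - V z₀ ∘L A‖ ^ 2) (𝓝 z₀) (𝓝 0) :=
    squeeze_zero (fun z => by positivity) (fun z => norm_sq_le_of_hasSum e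
      (Summable.of_nonneg_of_le (fun i => by positivity) (hb z) hs).hasSum) key
  rw [ContinuousAt, tendsto_iff_norm_sub_tendsto_zero]
  have := hn.sqrt
  simpa [Real.sqrt_sq] using this

end HilbertSchmidt

/-! ### Roots of states -/

section Root

open ContinuousLinearMap

variable {H : Type} [NormedAddCommGroup H] [InnerProductSpace ℂ H] [CompleteSpace H]

theorem root_isSelfAdjoint (T : H →L[ℂ] H) : IsSelfAdjoint (root T) :=
  (CFC.sqrt_nonneg T).isSelfAdjoint

theorem adjoint_root (T : H →L[ℂ] H) : adjoint (root T) = root T :=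
  (root_isSelfAdjoint T).adjoint_eq

theorem root_comp_root {T : H →L[ℂ] H} (hT : T.IsPositive) : root T ∘L root T = T :=
  CFC.sqrt_mul_sqrt_self T ((nonneg_iff_isPositive T).2 hT)

theorem inner_root_left (T : H →L[ℂ] H) (f g : H) : ⟪root T f, g⟫_ℂ = ⟪f, root T g⟫_ℂ := by
  rw [← adjoint_inner_right, adjoint_root]

theorem inner_root_root {T : H →L[ℂ] H} (hT : T.IsPositive) (f g : H) :
    ⟪root T f, root T g⟫_ℂ = ⟪f, T g⟫_ℂ := by
  rw [inner_root_left]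
  conv_rhs => rw [← root_comp_root hT]
  rfl

theorem IsDensity.hsPair {T : H →L[ℂ] H} (hT : IsDensity T) : HSPair (root T) (root T) 1 := by
  intro ι e
  simpa only [inner_root_root hT.1] using hT.2 ι e

end Root

/-! ### Random displacements of a state -/

section Displacement

open ContinuousLinearMap Filter Topology

/-- Exchanging a sum over a basis with an integral requires a countable index set. Distinct basis
vectors are `√2` apart, so balls of radius `1 / 2` around them are disjoint, which separability
allows only countably often. -/
theorem countable_of_hilbertBasis {H : Type} [NormedAddCommGroup H] [InnerProductSpace ℂ H]
    [SecondCountableTopology H] {ι : Type*} (e : HilbertBasis ι ℂ H) : Countable ι := by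
  have hd : ∀ i j, i ≠ j → 1 < dist (e i) (e j) := by
    intro i j hij
    have h : ‖e i - e j‖ ^ 2 = 2 := by
      rw [@norm_sub_sq ℂ, e.orthonormal.1 i, e.orthonormal.1 j, e.orthonormal.2 hij]
      norm_num
    rw [dist_eq_norm]
    nlinarith [norm_nonneg (e i - e j)]
  have hdisj : (Set.univ : Set ι).PairwiseDisjoint fun i => Metric.ball (e i) (1 / 2) := by
    intro i _ j _ hij
    refine Metric.ball_disjoint_ball ?_
    linarith [hd i j hij]
  have := hdisj.countable_of_isOpen (fun i _ => Metric.isOpen_ball)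
    fun i _ => ⟨e i, Metric.mem_ball_self (by norm_num)⟩
  exact Set.countable_univ_iff.1 this

/-- `σ` is the mixture of the states `W(ω)† ρ W(ω)`, and the unitaries `W(ω)` leave invariant a
dense space of test vectors, the range of `incl`. -/
structure Displacement {H : Type} [NormedAddCommGroup H] [InnerProductSpace ℂ H] [CompleteSpace H]
    {Ω : Type*} [MeasurableSpace Ω] (P : Measure Ω) (E : Type*) [AddCommGroup E] [Module ℂ E]
    (ρ σ : H →L[ℂ] H) where
  W : Ω → H ≃ₗᵢ[ℂ] H
  meas : ∀ f, AEStronglyMeasurable (fun ω => W ω f) P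
  incl : E →ₗ[ℂ] H
  dense : DenseRange incl
  act : Ω → E → E
  incl_act : ∀ ω φ, incl (act ω φ) = W ω (incl φ)
  density : IsDensity ρ
  pos : σ.IsPositive
  mix : ∀ f g, ⟪f, σ g⟫_ℂ = ∫ ω, ⟪W ω f, ρ (W ω g)⟫_ℂ ∂P

namespace Displacement

variable {H : Type} [NormedAddCommGroup H] [InnerProductSpace ℂ H] [CompleteSpace H]
  {Ω : Type*} [MeasurableSpace Ω] {P : Measure Ω} {E : Type*} [AddCommGroup E] [Module ℂ E]
  {ρ σ : H →L[ℂ] H}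

/-- An observable, given by its action `op` on test vectors, with finite second moment in the
state `ρ`, which the displacement shifts by `c`; `B` is the adjoint of the product of the
observable with `√ρ`. -/
structure Observable (S : Displacement P E ρ σ) where
  op : E →ₗ[ℂ] E
  c : Ω → ℝ
  memLp : MemLp c 2 P
  mean : ∫ ω, c ω ∂P = 0
  shift : ∀ ω φ, S.W ω (S.incl (op φ)) =
    S.incl (op (S.act ω φ)) - (c ω : ℂ) • S.W ω (S.incl φ)
  B : H →L[ℂ] H
  root_op : ∀ φ, root ρ (S.incl (op φ)) = B (S.incl φ)
  hs : IsHS B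

/-- The identity observable. -/
def one (S : Displacement P E ρ σ) : S.Observable where
  op := LinearMap.id
  c := 0
  memLp := MemLp.zero
  mean := by simp
  shift ω φ := by simp [S.incl_act]
  B := root ρ
  root_op φ := rfl
  hs := S.density.hsPair.isHS

/-! ### Moments of shifted observables in the mixed state. -/

namespace Observable

variable {S : Displacement P E ρ σ} (X Y : S.Observable)

/-- The adjoint of `(X - c) √ρ`. -/
def centred (ω : Ω) : H →L[ℂ] H := X.B - (X.c ω : ℂ) • root ρ

/-- Here the unbounded observable is traded for a bounded operator: the displacement turns `op` into
`op - c`, and `√ρ op` is `B`. -/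
theorem root_W_op (ω : Ω) (φ : E) :
    root ρ (S.W ω (S.incl (X.op φ))) = X.centred ω (S.W ω (S.incl φ)) := by
  rw [X.shift, map_sub, map_smul, X.root_op, S.incl_act]
  rfl

/-- A square integrable bound of the norm of `X.centred`. -/
def bound (ω : Ω) : ℝ := ‖X.B‖ + ‖X.c ω‖ * ‖root ρ‖

theorem bound_nonneg (ω : Ω) : 0 ≤ X.bound ω := by
  unfold bound
  positivity

theorem memLp_bound [IsFiniteMeasure P] : MemLp X.bound 2 P := by
  have h1 : MemLp (fun _ : Ω => ‖X.B‖) 2 P := memLp_const _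
  have h2 : MemLp (fun ω => ‖X.c ω‖ * ‖root ρ‖) 2 P := X.memLp.norm.mul_const _
  exact h1.add h2

theorem norm_centred_apply_le (ω : Ω) (f : H) : ‖X.centred ω (S.W ω f)‖ ≤ X.bound ω * ‖f‖ := by
  refine (le_opNorm _ _).trans ?_
  rw [LinearIsometryEquiv.norm_map]
  gcongr
  refine (norm_sub_le _ _).trans_eq ?_
  rw [norm_smul, Complex.norm_real, bound]

theorem meas_centred (f : H) : AEStronglyMeasurable (fun ω => X.centred ω (S.W ω f)) P := by
  have h1 := X.B.continuous.comp_aestronglyMeasurable (S.meas f)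
  have h2 := (root ρ).continuous.comp_aestronglyMeasurable (S.meas f)
  have h3 : AEStronglyMeasurable (fun ω => (X.c ω : ℂ)) P :=
    Complex.continuous_ofReal.comp_aestronglyMeasurable X.memLp.1
  exact h1.sub (h3.smul h2)

/-- `√σ` has no expression through `√ρ`, but its inner products only involve `σ`, and there the
mixture formula applies. -/
theorem inner_root_op (φ ψ : E) :
    ⟪root σ (S.incl (X.op φ)), root σ (S.incl (Y.op ψ))⟫_ℂ =
      ∫ ω, ⟪X.centred ω (S.W ω (S.incl φ)), Y.centred ω (S.W ω (S.incl ψ))⟫_ℂ ∂P := by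
  rw [inner_root_root S.pos, S.mix]
  congr 1
  funext ω
  rw [← inner_root_root S.density.1, root_W_op, root_W_op]

/-- This is the boundedness that lets `√σ X` extend from test vectors to the operator `mixed`. -/
theorem norm_root_op_le [IsFiniteMeasure P] (φ : E) : ‖root σ (S.incl (X.op φ))‖ ≤
    √(∫ ω, X.bound ω ^ 2 ∂P) * ‖S.incl φ‖ := by
  have h1 : ‖root σ (S.incl (X.op φ))‖ ^ 2 ≤ (∫ ω, X.bound ω ^ 2 ∂P) * ‖S.incl φ‖ ^ 2 := by
    have h2 : ‖⟪root σ (S.incl (X.op φ)), root σ (S.incl (X.op φ))⟫_ℂ‖ ≤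
        ∫ ω, X.bound ω ^ 2 * ‖S.incl φ‖ ^ 2 ∂P := by
      rw [inner_root_op]
      refine norm_integral_le_of_norm_le (X.memLp_bound.integrable_sq.mul_const _)
        (Eventually.of_forall fun ω => ?_)
      refine (norm_inner_le_norm _ _).trans ?_
      rw [← sq, ← mul_pow]
      gcongr
      exact X.norm_centred_apply_le _ _
    rw [integral_mul_const] at h2
    refine le_trans (le_of_eq ?_) h2
    rw [inner_self_eq_norm_sq_to_K]
    simp
  refine (Real.le_sqrt_of_sq_le h1).trans ?_
  rw [Real.sqrt_mul (integral_nonneg fun ω => sq_nonneg _), Real.sqrt_sq (norm_nonneg _)]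

/-- The adjoint of `X √σ`. -/
def mixed : H →L[ℂ] H :=
  LinearMap.extendOfNorm ((root σ).toLinearMap ∘ₗ S.incl ∘ₗ X.op) S.incl

theorem mixed_incl [IsFiniteMeasure P] (φ : E) :
    X.mixed (S.incl φ) = root σ (S.incl (X.op φ)) :=
  LinearMap.extendOfNorm_eq (f := (root σ).toLinearMap ∘ₗ S.incl ∘ₗ X.op) S.dense
    ⟨_, X.norm_root_op_le⟩ φ

theorem mixed_one [IsFiniteMeasure P] : S.one.mixed = root σ := by
  have h : (S.one.mixed : H → H) = root σ :=
    S.dense.equalizer S.one.mixed.continuous (root σ).continuous (funext fun φ => S.one.mixed_incl φ)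
  exact ContinuousLinearMap.ext (congrFun h)

theorem meas_inner_centred (f g : H) :
    AEStronglyMeasurable (fun ω => ⟪X.centred ω (S.W ω f), Y.centred ω (S.W ω g)⟫_ℂ) P :=
  (X.meas_centred f).inner (Y.meas_centred g)

/-- Basis vectors need not be test vectors; joint continuity carries `inner_root_op` to all vectors
by density. The integrand is dominated uniformly on the ball of radius `‖u₀‖ + 1`. -/
theorem continuous_integral_inner [IsFiniteMeasure P] : Continuous fun u : H × H =>
    ∫ ω, ⟪X.centred ω (S.W ω u.1), Y.centred ω (S.W ω u.2)⟫_ℂ ∂P := by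
  rw [continuous_iff_continuousAt]
  intro u₀
  have hb : Integrable (fun ω => X.bound ω * Y.bound ω * ((‖u₀‖ + 1) * (‖u₀‖ + 1))) P :=
    (X.memLp_bound.integrable_mul Y.memLp_bound).mul_const _
  refine continuousAt_of_dominated (Eventually.of_forall fun u => X.meas_inner_centred Y u.1 u.2)
    ?_ hb (Eventually.of_forall fun ω => ?_)
  · filter_upwards [continuous_norm.continuousAt.eventually_lt continuousAt_const
      (show ‖u₀‖ < ‖u₀‖ + 1 by linarith)] with u hu
    refine Eventually.of_forall fun ω => ?_
    have h1 : ‖u.1‖ ≤ ‖u₀‖ + 1 := (norm_fst_le u).trans hu.le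
    have h2 : ‖u.2‖ ≤ ‖u₀‖ + 1 := (norm_snd_le u).trans hu.le
    have hX := X.bound_nonneg ω
    have hY := Y.bound_nonneg ω
    calc _ ≤ ‖X.centred ω (S.W ω u.1)‖ * ‖Y.centred ω (S.W ω u.2)‖ := norm_inner_le_norm _ _
      _ ≤ (X.bound ω * (‖u₀‖ + 1)) * (Y.bound ω * (‖u₀‖ + 1)) := by
        gcongr
        · exact (X.norm_centred_apply_le ω _).trans (by gcongr)
        · exact (Y.norm_centred_apply_le ω _).trans (by gcongr)
      _ = _ := by ring
  · have : Continuous fun u : H × H =>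
        ⟪X.centred ω (S.W ω u.1), Y.centred ω (S.W ω u.2)⟫_ℂ := by fun_prop
    exact this.continuousAt

theorem inner_mixed [IsFiniteMeasure P] (f g : H) : ⟪X.mixed f, Y.mixed g⟫_ℂ =
    ∫ ω, ⟪X.centred ω (S.W ω f), Y.centred ω (S.W ω g)⟫_ℂ ∂P := by
  have h : (fun u : H × H => ⟪X.mixed u.1, Y.mixed u.2⟫_ℂ) = fun u : H × H =>
      ∫ ω, ⟪X.centred ω (S.W ω u.1), Y.centred ω (S.W ω u.2)⟫_ℂ ∂P := by
    refine (S.dense.prodMap S.dense).equalizer (by fun_prop) (X.continuous_integral_inner Y) ?_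
    funext φ
    simp only [Function.comp_apply, Prod.map_fst, Prod.map_snd, mixed_incl]
    exact X.inner_root_op Y _ _
  exact congrFun h (f, g)

theorem hsPair_centred {m a b : ℂ} (hm : HSPair X.B Y.B m) (ha : HSPair X.B (root ρ) a)
    (hb : HSPair (root ρ) Y.B b) (ω : Ω) : HSPair (X.centred ω) (Y.centred ω)
      (m - Y.c ω * a - X.c ω * b + X.c ω * Y.c ω) := by
  intro ι e
  have h := (((hm ι e).sub ((ha ι e).mul_left (Y.c ω : ℂ))).sub
    ((hb ι e).mul_left (X.c ω : ℂ))).add ((S.density.hsPair ι e).mul_left (X.c ω * Y.c ω : ℂ))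
  rw [mul_one] at h
  have e1 : ∀ i, ⟪X.centred ω (e i), Y.centred ω (e i)⟫_ℂ = ⟪X.B (e i), Y.B (e i)⟫_ℂ -
      Y.c ω * ⟪X.B (e i), root ρ (e i)⟫_ℂ - X.c ω * ⟪root ρ (e i), Y.B (e i)⟫_ℂ +
      X.c ω * Y.c ω * ⟪root ρ (e i), root ρ (e i)⟫_ℂ := by
    intro i
    simp only [centred, sub_apply, smul_apply, inner_sub_left, inner_sub_right, inner_smul_left,
      inner_smul_right, Complex.conj_ofReal]
    ring
  simp only [e1]
  exact h

theorem integrable_c [IsFiniteMeasure P] : Integrable (fun ω => (X.c ω : ℂ)) P :=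
  (X.memLp.integrable (by norm_num)).ofReal

theorem integrable_c_mul : Integrable (fun ω => (X.c ω * Y.c ω : ℂ)) P := by
  simpa using (X.memLp.integrable_mul Y.memLp).ofReal (𝕜 := ℂ)

theorem integrable_hsPair [IsFiniteMeasure P] (m a b : ℂ) :
    Integrable (fun ω => (m - Y.c ω * a - X.c ω * b + X.c ω * Y.c ω : ℂ)) P :=
  (((integrable_const m).sub (Y.integrable_c.mul_const a)).sub (X.integrable_c.mul_const b)).add
    (X.integrable_c_mul Y)

/-- This supplies the majorant for `hsPair_mixed`. As `W ω` maps bases to bases, the sum is the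
squared Hilbert-Schmidt norm of `centred`, a quadratic polynomial in `c`, hence integrable. -/
theorem exists_hasSum_norm_sq [IsFiniteMeasure P] : ∃ s : Ω → ℝ, Integrable s P ∧
    ∀ ω (ι : Type) (e : HilbertBasis ι ℂ H),
      HasSum (fun i => ‖X.centred ω (S.W ω (e i))‖ ^ 2) (s ω) := by
  obtain ⟨m, hm, -⟩ := X.hs.exists_pair X.hs
  obtain ⟨a, ha, -⟩ := X.hs.exists_pair S.density.hsPair.isHS
  refine ⟨_, (X.integrable_hsPair X m a (starRingEnd ℂ a)).re, fun ω ι e => ?_⟩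
  have h := Complex.hasSum_re (X.hsPair_centred X hm ha ha.symm ω ι (mapBasis e (S.W ω)))
  simp only [mapBasis_apply, inner_self_eq_norm_sq_to_K] at h
  convert! h using 2 with i
  norm_cast

theorem hsPair_mixed [SecondCountableTopology H] [IsProbabilityMeasure P] {m : ℂ}
    (hm : HSPair X.B Y.B m) : HSPair X.mixed Y.mixed (m + ((∫ ω, X.c ω * Y.c ω ∂P : ℝ) : ℂ)) := by
  intro ι e
  have := countable_of_hilbertBasis e
  obtain ⟨a, ha, -⟩ := X.hs.exists_pair S.density.hsPair.isHS
  obtain ⟨b, hb, -⟩ := S.density.hsPair.isHS.exists_pair Y.hs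
  obtain ⟨s, hs, hs'⟩ := X.exists_hasSum_norm_sq
  obtain ⟨t, ht, ht'⟩ := Y.exists_hasSum_norm_sq
  have hst : ∀ ω, HasSum (fun i => ‖X.centred ω (S.W ω (e i))‖ ^ 2 +
      ‖Y.centred ω (S.W ω (e i))‖ ^ 2) (s ω + t ω) := fun ω => (hs' ω ι e).add (ht' ω ι e)
  have key := hasSum_integral_of_dominated_convergence (μ := P)
    (F := fun i ω => ⟪X.centred ω (S.W ω (e i)), Y.centred ω (S.W ω (e i))⟫_ℂ)
    (f := fun ω => (m - Y.c ω * a - X.c ω * b + X.c ω * Y.c ω : ℂ))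
    (fun i ω => ‖X.centred ω (S.W ω (e i))‖ ^ 2 + ‖Y.centred ω (S.W ω (e i))‖ ^ 2)
    (fun i => X.meas_inner_centred Y _ _)
    (fun i => Eventually.of_forall fun ω => (norm_inner_le_norm _ _).trans (by
      nlinarith [sq_nonneg (‖X.centred ω (S.W ω (e i))‖ - ‖Y.centred ω (S.W ω (e i))‖),
        sq_nonneg ‖X.centred ω (S.W ω (e i))‖, sq_nonneg ‖Y.centred ω (S.W ω (e i))‖]))
    (Eventually.of_forall fun ω => (hst ω).summable)
    (by simp only [(hst _).tsum_eq]; exact hs.add ht)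
    (Eventually.of_forall fun ω => by
      -- For fixed `ω` the series is the Hilbert-Schmidt product of the centred operators, computed
      -- in the basis `W ω e`.
      have h := X.hsPair_centred Y hm ha hb ω ι (mapBasis e (S.W ω))
      simpa only [mapBasis_apply] using h)
  simp only [← inner_mixed] at key
  convert! key using 1
  -- The cross terms are linear in the shifts and integrate to zero; only `m` and the integral of
  -- the product of the shifts remain.
  have hX : ∫ ω, (X.c ω : ℂ) ∂P = 0 := by rw [integral_complex_ofReal, X.mean]; rfl
  have hY : ∫ ω, (Y.c ω : ℂ) ∂P = 0 := by rw [integral_complex_ofReal, Y.mean]; rfl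
  rw [integral_add _ (X.integrable_c_mul Y), integral_sub _ (X.integrable_c.mul_const b),
    integral_sub (integrable_const m) (Y.integrable_c.mul_const a), integral_mul_const,
    integral_mul_const, hX, hY, ← integral_complex_ofReal]
  · simp
  · exact (integrable_const m).sub (Y.integrable_c.mul_const a)
  · exact ((integrable_const m).sub (Y.integrable_c.mul_const a)).sub (X.integrable_c.mul_const b)

theorem isHS_mixed [SecondCountableTopology H] [IsProbabilityMeasure P] : IsHS X.mixed := by
  obtain ⟨m, hm, -⟩ := X.hs.exists_pair X.hs
  exact (X.hsPair_mixed X hm).isHS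

end Observable

end Displacement

end Displacement

/-! ### Unbounded observables given by their action on test vectors -/

section TestVectors

open ContinuousLinearMap Filter Topology

variable {H : Type} [NormedAddCommGroup H] [InnerProductSpace ℂ H] [CompleteSpace H]
  {E : Type*} [AddCommGroup E] [Module ℂ E]

/-- `X` is the adjoint of the operator `incl φ ↦ incl (op φ)`. -/
def IsAdjointOf (X : H →ₗ.[ℂ] H) (incl : E →ₗ[ℂ] H) (op : E →ₗ[ℂ] E) : Prop :=
  ∀ v w : H, (v, w) ∈ X.graph ↔ ∀ φ, ⟪incl (op φ), v⟫_ℂ = ⟪incl φ, w⟫_ℂ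

variable {X : H →ₗ.[ℂ] H} {incl : E →ₗ[ℂ] H} {op : E →ₗ[ℂ] E}

theorem mem_graph_obsRoot {T : H →L[ℂ] H} (h : Applicable T X) (f : H) :
    (root T f, obsRoot h f) ∈ X.graph :=
  X.mem_graph ⟨root T f, h f⟩

/-- Membership of `(√T f, B† f)` in the graph of an adjoint is tested on test vectors only, where it
is the hypothesis on `B`. -/
theorem IsAdjointOf.exists_obsRoot_eq (hX : IsAdjointOf X incl op) {T B : H →L[ℂ] H}
    (hB : ∀ φ, root T (incl (op φ)) = B (incl φ)) :
    ∃ h : Applicable T X, ∀ f, obsRoot h f = adjoint B f := by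
  have hg : ∀ f, (root T f, adjoint B f) ∈ X.graph := by
    intro f
    rw [hX]
    intro φ
    rw [← inner_root_left, hB, adjoint_inner_right]
  have h : Applicable T X := fun f => LinearPMap.mem_domain_of_mem_graph (hg f)
  exact ⟨h, fun f => X.mem_graph_snd_inj (mem_graph_obsRoot h f) (hg f) rfl⟩

/-- The linear map `X √T`. -/
def obsRootₗ {T : H →L[ℂ] H} (h : Applicable T X) : H →ₗ[ℂ] H :=
  X.toFun ∘ₗ (root T).toLinearMap.codRestrict X.domain h

/-- Adjoints are closed, so the everywhere defined `X √T` is bounded by the closed graph theorem. -/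
theorem IsAdjointOf.continuous_obsRoot (hX : IsAdjointOf X incl op) {T : H →L[ℂ] H}
    (h : Applicable T X) : Continuous (obsRootₗ h) := by
  refine LinearMap.continuous_of_seq_closed_graph _ fun u x y hx hy => ?_
  refine X.mem_graph_snd_inj (x' := y) ?_ (mem_graph_obsRoot h x) rfl
  rw [hX]
  intro φ
  have h1 : Tendsto (fun n => ⟪incl (op φ), root T (u n)⟫_ℂ) atTop (𝓝 ⟪incl (op φ), root T x⟫_ℂ) :=
    tendsto_const_nhds.inner (((root T).continuous.tendsto x).comp hx)
  have h2 : Tendsto (fun n => ⟪incl φ, obsRootₗ h (u n)⟫_ℂ) atTop (𝓝 ⟪incl φ, y⟫_ℂ) :=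
    tendsto_const_nhds.inner hy
  refine tendsto_nhds_unique h1 (h2.congr fun n => ?_)
  exact ((hX _ _).1 (mem_graph_obsRoot h (u n)) φ).symm

theorem IsAdjointOf.exists_root_op (hX : IsAdjointOf X incl op) {T : H →L[ℂ] H}
    (h : HasFiniteSecondMoment T X) :
    ∃ B : H →L[ℂ] H, (∀ φ, root T (incl (op φ)) = B (incl φ)) ∧ IsHS B := by
  obtain ⟨h, hs⟩ := h
  let A : H →L[ℂ] H := ⟨obsRootₗ h, hX.continuous_obsRoot h⟩
  refine ⟨adjoint A, fun φ => ext_inner_right ℂ fun f => ?_, ?_⟩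
  · rw [inner_root_left, adjoint_inner_left]
    exact (hX _ _).1 (mem_graph_obsRoot h f) φ
  · exact IsHS.adjoint fun ι e => hs ι e

variable {Ω : Type*} [MeasurableSpace Ω] {P : Measure Ω} [IsProbabilityMeasure P]
  {ρ σ : H →L[ℂ] H} [SecondCountableTopology H]
  {S : Displacement P E ρ σ} (x y : S.Observable) {Y : H →ₗ.[ℂ] H}

theorem IsAdjointOf.hasFiniteSecondMoment (hX : IsAdjointOf X S.incl x.op) :
    HasFiniteSecondMoment σ X := by
  obtain ⟨h, hh⟩ := hX.exists_obsRoot_eq fun φ => (x.mixed_incl φ).symm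
  refine ⟨h, fun ι e => ?_⟩
  simp only [hh]
  exact x.isHS_mixed.adjoint ι e

theorem IsAdjointOf.hasExpectation (hX : IsAdjointOf X S.incl x.op) {m : ℝ}
    (h : HasExpectation ρ X m) : HasExpectation σ X m := by
  obtain ⟨h₁, hm⟩ := h
  obtain ⟨h₂, hh₂⟩ := hX.exists_obsRoot_eq x.root_op
  obtain ⟨h₃, hh₃⟩ := hX.exists_obsRoot_eq fun φ => (x.mixed_incl φ).symm
  have hR := S.density.hsPair.isHS
  obtain ⟨d, hd, hd'⟩ := x.hs.exists_pair hR
  obtain ⟨w, e₀, -⟩ := exists_hilbertBasis ℂ H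
  have hdm : d = m := by
    have h := hd' w e₀
    rw [adjoint_root] at h
    simp only [← hh₂] at h
    exact h.unique (hm w e₀)
  subst hdm
  -- The mean is the pairing of `X` with the identity observable, whose shift is zero, so the added
  -- integral vanishes.
  have h := (x.hsPair_mixed S.one hd).adjoint x.isHS_mixed S.one.isHS_mixed
  rw [Displacement.Observable.mixed_one, adjoint_root] at h
  refine ⟨h₃, fun ι e => ?_⟩
  simp only [hh₃]
  convert! h ι e using 1
  simp [Displacement.one]

theorem IsAdjointOf.hasSymmProductExpectation (hX : IsAdjointOf X S.incl x.op)
    (hY : IsAdjointOf Y S.incl y.op) {m : ℝ} (h : HasSymmProductExpectation ρ X Y m) :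
    HasSymmProductExpectation σ X Y (m + ∫ ω, x.c ω * y.c ω ∂P) := by
  -- Symmetrising takes the real part of the Hilbert-Schmidt product, which makes the reversal of
  -- order under adjoints harmless.
  have symm_pair : ∀ {A B : H →L[ℂ] H} {d : ℂ}, HSPair A B d → ∀ (ι : Type)
      (e : HilbertBasis ι ℂ H), HasSum (fun i => (1 / 2 : ℂ) * (⟪B (e i), A (e i)⟫_ℂ +
        ⟪A (e i), B (e i)⟫_ℂ)) (d.re : ℂ) := by
    intro A B d hd ι e
    convert! ((hd.symm ι e).add (hd ι e)).mul_left (1 / 2 : ℂ) using 1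
    rw [add_comm, Complex.add_conj]
    push_cast
    ring
  obtain ⟨_, _, hm⟩ := h
  obtain ⟨h₂, hh₂⟩ := hX.exists_obsRoot_eq x.root_op
  obtain ⟨h₃, hh₃⟩ := hX.exists_obsRoot_eq fun φ => (x.mixed_incl φ).symm
  obtain ⟨k₂, hk₂⟩ := hY.exists_obsRoot_eq y.root_op
  obtain ⟨k₃, hk₃⟩ := hY.exists_obsRoot_eq fun φ => (y.mixed_incl φ).symm
  obtain ⟨d, hd, hd'⟩ := x.hs.exists_pair y.hs
  obtain ⟨w, e₀, -⟩ := exists_hilbertBasis ℂ H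
  have hdm : (d.re : ℂ) = m := by
    have h := symm_pair hd' w e₀
    simp only [← hh₂, ← hk₂] at h
    exact h.unique (hm w e₀)
  have hdm' : d.re = m := by exact_mod_cast hdm
  refine ⟨h₃, k₃, fun ι e => ?_⟩
  simp only [hh₃, hk₃]
  convert! symm_pair ((x.hsPair_mixed y hd).adjoint x.isHS_mixed y.isHS_mixed) ι e using 2
  rw [Complex.add_re, hdm', Complex.ofReal_re]

theorem IsAdjointOf.hasCovariance (hX : IsAdjointOf X S.incl x.op)
    (hY : IsAdjointOf Y S.incl y.op) {κ : ℝ} (h : HasCovariance ρ X Y κ) :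
    HasCovariance σ X Y (κ + ∫ ω, x.c ω * y.c ω ∂P) := by
  obtain ⟨m, mX, mY, hm, h₁, h₂, rfl⟩ := h
  exact ⟨_, mX, mY, hX.hasSymmProductExpectation x y hY hm, hX.hasExpectation x h₁,
    hY.hasExpectation y h₂, by ring⟩

end TestVectors

/-! ### Weyl operators are unitary, strongly continuous and compatible with the tensor structure -/

section Weyl

open ContinuousLinearMap Filter Topology

variable {k n : ℕ}

theorem norm_weyl (z : Fin n → Fin k → ℂ) (f : Hilb k n) : ‖weyl z f‖ = ‖f‖ := by
  change ‖phaseOp z (Lp.compMeasurePreservingₗᵢ ℂ (fun x : Config k n => x - weylShift z)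
      (measurePreserving_sub_right volume (weylShift z)) f)‖ = ‖f‖
  rw [LinearIsometry.norm_map, LinearIsometry.norm_map]

theorem weylShift_neg (z : Fin n → Fin k → ℂ) : weylShift (-z) = -weylShift z := by
  funext i j
  simp [weylShift]

theorem weylPhase_add_neg (z : Fin n → Fin k → ℂ) (x : Config k n) :
    weylPhase z x + weylPhase (-z) (x - weylShift z) = 0 := by
  simp only [weylPhase, ← Finset.sum_add_distrib]
  refine Finset.sum_eq_zero fun i _ => Finset.sum_eq_zero fun j _ => ?_
  simp only [weylShift, Pi.neg_apply, Pi.sub_apply, Complex.neg_im, Complex.neg_re]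
  -- The translation contributes `√2 * √2 = 2` times `Re z Im z`, cancelling the two constants `-Re
  -- z Im z`.
  linear_combination (z i j).im * (z i j).re * Real.mul_self_sqrt (show (0 : ℝ) ≤ 2 by norm_num)

theorem weyl_weyl_neg (z : Fin n → Fin k → ℂ) (f : Hilb k n) : weyl z (weyl (-z) f) = f := by
  apply Lp.ext
  have hp := measurePreserving_sub_right (volume : Measure (Config k n)) (weylShift z)
  filter_upwards [weyl_coeFn z (weyl (-z) f),
    hp.quasiMeasurePreserving.ae_eq_comp (weyl_coeFn (-z) f)] with x h1 h2
  simp only [Function.comp_apply] at h2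
  rw [h1, h2, ← mul_assoc, ← Complex.exp_add, ← mul_add, ← Complex.ofReal_add, weylPhase_add_neg,
    weylShift_neg]
  simp

/-- The Weyl operators as unitaries. -/
def weylEquiv (z : Fin n → Fin k → ℂ) : Hilb k n ≃ₗᵢ[ℂ] Hilb k n :=
  LinearIsometryEquiv.ofSurjective ⟨(weyl z).toLinearMap, norm_weyl z⟩
    fun f => ⟨weyl (-z) f, weyl_weyl_neg z f⟩

theorem inner_weyl_weyl (z : Fin n → Fin k → ℂ) (f g : Hilb k n) :
    ⟪weyl z f, weyl z g⟫_ℂ = ⟪f, g⟫_ℂ :=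
  (weylEquiv z).inner_map_map f g

theorem adjoint_weyl (z : Fin n → Fin k → ℂ) : adjoint (weyl z) = weyl (-z) := by
  symm
  rw [eq_adjoint_iff]
  intro f g
  rw [← inner_weyl_weyl z, weyl_weyl_neg]

theorem phaseOp_coeFn (z : Fin n → Fin k → ℂ) (f : Hilb k n) :
    phaseOp z f =ᵐ[volume] fun x => Complex.exp (Complex.I * (weylPhase z x : ℂ)) * f x :=
  (memLp_phase z f).coeFn_toLp

theorem continuous_weylPhase_left (x : Config k n) :
    Continuous fun z : Fin n → Fin k → ℂ => weylPhase z x := by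
  unfold weylPhase
  fun_prop

theorem continuous_weylShift : Continuous (weylShift : (Fin n → Fin k → ℂ) → Config k n) := by
  unfold weylShift
  fun_prop

theorem continuous_inner_phaseOp (f g : Hilb k n) :
    Continuous fun z : Fin n → Fin k → ℂ => ⟪phaseOp z f, g⟫_ℂ := by
  have h : ∀ z : Fin n → Fin k → ℂ, ⟪phaseOp z f, g⟫_ℂ =
      ∫ x, ⟪Complex.exp (Complex.I * (weylPhase z x : ℂ)) * f x, g x⟫_ℂ := by
    intro z
    rw [L2.inner_def]
    refine integral_congr_ae ?_
    filter_upwards [phaseOp_coeFn z f] with x hx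
    rw [hx]
  simp only [h]
  refine continuous_of_dominated (bound := fun x => ‖f x‖ * ‖g x‖) (fun z => ?_) (fun z => ?_)
    ((Lp.memLp f).norm.integrable_mul (Lp.memLp g).norm) (Eventually.of_forall fun x => ?_)
  · exact (memLp_phase z f).1.inner (Lp.memLp g).1
  · refine Eventually.of_forall fun x => (norm_inner_le_norm _ _).trans_eq ?_
    rw [norm_mul, norm_exp_phase, one_mul]
  · have := continuous_weylPhase_left x
    fun_prop

theorem continuous_phaseOp (f : Hilb k n) :
    Continuous fun z : Fin n → Fin k → ℂ => phaseOp z f := by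
  rw [continuous_iff_continuousAt]
  intro z₀
  rw [ContinuousAt, tendsto_iff_norm_sub_tendsto_zero]
  -- For isometries weak continuity implies strong continuity, since the norms in the expansion are
  -- constant.
  have h : ∀ z, ‖phaseOp z f - phaseOp z₀ f‖ ^ 2 =
      2 * ‖f‖ ^ 2 - 2 * (⟪phaseOp z f, phaseOp z₀ f⟫_ℂ).re := by
    intro z
    rw [@norm_sub_sq ℂ, LinearIsometry.norm_map, LinearIsometry.norm_map]
    simp only [RCLike.re_to_complex]
    ring
  have hc : Continuous fun z => ‖phaseOp z f - phaseOp z₀ f‖ ^ 2 := by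
    simp only [h]
    have := continuous_inner_phaseOp f (phaseOp z₀ f)
    fun_prop
  have h2 := (hc.sqrt).tendsto z₀
  simpa [Real.sqrt_sq] using h2

/-- Used to compose the phase and the translation: strong continuity survives products of uniformly
Lipschitz families. -/
theorem continuous_apply_of_lipschitz {Z F : Type*} [TopologicalSpace Z] [PseudoEMetricSpace F]
    {V : Z → F → F} (hV : ∀ z, LipschitzWith 1 (V z)) (hc : ∀ f, Continuous fun z => V z f)
    {u : Z → F} (hu : Continuous u) : Continuous fun z => V z (u z) :=
  (continuous_prod_of_continuous_lipschitzWith (fun p : F × Z => V p.2 p.1) 1 hc hV).comp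
    (hu.prodMk continuous_id)

/-- The translation by `weylShift z`. -/
def shiftOp (z : Fin n → Fin k → ℂ) : Hilb k n →ₗᵢ[ℂ] Hilb k n :=
  Lp.compMeasurePreservingₗᵢ ℂ (fun x : Config k n => x - weylShift z)
    (measurePreserving_sub_right volume (weylShift z))

theorem continuous_shiftOp (f : Hilb k n) :
    Continuous fun z : Fin n → Fin k → ℂ => shiftOp z f := by
  let g : (Fin n → Fin k → ℂ) → C(Config k n, Config k n) := fun z =>
    ⟨fun x => x - weylShift z, by fun_prop⟩
  have hg : Continuous g := by
    refine ContinuousMap.continuous_of_continuous_uncurry _ ?_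
    have := continuous_weylShift (k := k) (n := n)
    change Continuous fun p : (Fin n → Fin k → ℂ) × Config k n => p.2 - weylShift p.1
    fun_prop
  have hgm : ∀ z, MeasurePreserving (g z) (volume : Measure (Config k n)) volume :=
    fun z => measurePreserving_sub_right volume (weylShift z)
  have hf : Continuous fun _ : Fin n → Fin k → ℂ => f := continuous_const
  have h : Continuous fun z => Lp.compMeasurePreserving (g z) (hgm z) f :=
    Continuous.compMeasurePreservingLp hf hg hgm ENNReal.ofNat_ne_top
  exact h

theorem continuous_weyl (f : Hilb k n) :
    Continuous fun z : Fin n → Fin k → ℂ => weyl z f := by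
  have h : ∀ z : Fin n → Fin k → ℂ, LipschitzWith 1 (phaseOp (k := k) z) :=
    fun z => (phaseOp z).isometry.lipschitz
  exact continuous_apply_of_lipschitz h continuous_phaseOp (continuous_shiftOp f)

theorem permOp_coeFn (π : Equiv.Perm (Fin n)) (f : Hilb k n) :
    permOp k π f =ᵐ[volume] fun x => f fun i => x (π.symm i) :=
  Lp.coeFn_compMeasurePreserving f (measurePreserving_perm k π)

theorem permOp_permOp_symm (π : Equiv.Perm (Fin n)) (f : Hilb k n) :
    permOp k π (permOp k π.symm f) = f := by
  apply Lp.ext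
  filter_upwards [permOp_coeFn π (permOp k π.symm f),
    (measurePreserving_perm k π).quasiMeasurePreserving.ae_eq_comp (permOp_coeFn π.symm f)]
    with x h1 h2
  simp only [Function.comp_apply] at h2
  rw [h1, h2]
  simp

theorem inner_permOp_permOp (π : Equiv.Perm (Fin n)) (f g : Hilb k n) :
    ⟪permOp k π f, permOp k π g⟫_ℂ = ⟪f, g⟫_ℂ :=
  LinearIsometry.inner_map_map
    (Lp.compMeasurePreservingₗᵢ ℂ _ (measurePreserving_perm k π)) f g

theorem adjoint_permOp (π : Equiv.Perm (Fin n)) : adjoint (permOp k π) = permOp k π.symm := by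
  symm
  rw [eq_adjoint_iff]
  intro f g
  rw [← inner_permOp_permOp π, permOp_permOp_symm]

theorem permOp_weyl (π : Equiv.Perm (Fin n)) (z : Fin n → Fin k → ℂ) (f : Hilb k n) :
    permOp k π (weyl z f) = weyl (fun i => z (π i)) (permOp k π f) := by
  apply Lp.ext
  have hp := measurePreserving_sub_right (volume : Measure (Config k n))
    (weylShift fun i => z (π i))
  filter_upwards [permOp_coeFn π (weyl z f), weyl_coeFn (fun i => z (π i)) (permOp k π f),
    (measurePreserving_perm k π).quasiMeasurePreserving.ae_eq_comp (weyl_coeFn z f),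
    hp.quasiMeasurePreserving.ae_eq_comp (permOp_coeFn π f)] with x h1 h2 h3 h4
  simp only [Function.comp_apply] at h3 h4
  rw [h1, h2, h3, h4]
  have e1 : weylPhase z (fun i => x (π.symm i)) = weylPhase (fun i => z (π i)) x := by
    unfold weylPhase
    rw [← Equiv.sum_comp π]
    simp
  have e2 : (fun i => x (π.symm i)) - weylShift z =
      fun i => (x - weylShift fun i => z (π i)) (π.symm i) := by
    funext i j
    simp [weylShift]
  rw [e1, e2]

/-! ### The one-site Weyl operators -/

theorem measurePreserving_eval (k : ℕ) :
    MeasurePreserving (fun x : Config k 1 => x 0) volume volume :=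
  volume_preserving_funUnique (Fin 1) (Fin k → ℝ)

theorem measurePreserving_const (k : ℕ) :
    MeasurePreserving (fun (t : Fin k → ℝ) => (fun _ => t : Config k 1)) volume volume :=
  (volume_preserving_funUnique (Fin 1) (Fin k → ℝ)).symm
    (MeasurableEquiv.funUnique (Fin 1) (Fin k → ℝ))

/-- The identification of `L²(ℝᵏ)` with the Hilbert space of one site. -/
def siteEmbed (k : ℕ) : Site k →ₗᵢ[ℂ] Hilb k 1 :=
  Lp.compMeasurePreservingₗᵢ ℂ _ (measurePreserving_eval k)

/-- The inverse of `siteEmbed`. -/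
def siteProj (k : ℕ) : Hilb k 1 →ₗᵢ[ℂ] Site k :=
  Lp.compMeasurePreservingₗᵢ ℂ _ (measurePreserving_const k)

theorem siteEmbed_coeFn (g : Site k) : siteEmbed k g =ᵐ[volume] fun x => g (x 0) :=
  Lp.coeFn_compMeasurePreserving g (measurePreserving_eval k)

theorem siteProj_coeFn (h : Hilb k 1) : siteProj k h =ᵐ[volume] fun t => h fun _ => t :=
  Lp.coeFn_compMeasurePreserving h (measurePreserving_const k)

theorem siteEmbed_siteProj (h : Hilb k 1) : siteEmbed k (siteProj k h) = h := by
  apply Lp.ext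
  filter_upwards [siteEmbed_coeFn (siteProj k h),
    (measurePreserving_eval k).quasiMeasurePreserving.ae_eq_comp (siteProj_coeFn h)] with x h1 h2
  simp only [Function.comp_apply] at h2
  rw [h1, h2]
  congr 1
  funext i
  rw [Subsingleton.elim i 0]

theorem siteProj_siteEmbed (g : Site k) : siteProj k (siteEmbed k g) = g := by
  apply Lp.ext
  filter_upwards [siteProj_coeFn (siteEmbed k g),
    (measurePreserving_const k).quasiMeasurePreserving.ae_eq_comp (siteEmbed_coeFn g)] with x h1 h2
  simp only [Function.comp_apply] at h2
  rw [h1, h2]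

/-- The Weyl operator of one site. -/
def siteWeyl (z : Fin k → ℂ) : Site k ≃ₗᵢ[ℂ] Site k :=
  LinearIsometryEquiv.ofSurjective
    ((siteProj k).comp ((weylEquiv fun _ => z).toLinearIsometry.comp (siteEmbed k))) fun g =>
      ⟨siteProj k (weyl (-fun _ => z) (siteEmbed k g)), by
        change siteProj k (weyl (fun _ => z)
          (siteEmbed k (siteProj k (weyl (-fun _ => z) (siteEmbed k g))))) = g
        rw [siteEmbed_siteProj, weyl_weyl_neg, siteProj_siteEmbed]⟩

theorem siteWeyl_coeFn (z : Fin k → ℂ) (g : Site k) : siteWeyl z g =ᵐ[volume] fun t =>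
    Complex.exp (Complex.I * (weylPhase (n := 1) (fun _ => z) (fun _ => t) : ℂ)) *
      g (t - fun j => √2 * (z j).re) := by
  have hp := measurePreserving_sub_right (volume : Measure (Config k 1))
    (weylShift (n := 1) fun _ => z)
  have hc := (measurePreserving_const k).quasiMeasurePreserving
  filter_upwards [siteProj_coeFn (weyl (fun _ => z) (siteEmbed k g)),
    hc.ae_eq_comp (weyl_coeFn (fun _ => z) (siteEmbed k g)),
    hc.ae_eq_comp (hp.quasiMeasurePreserving.ae_eq_comp (siteEmbed_coeFn g))] with t h1 h2 h3
  simp only [Function.comp_apply] at h2 h3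
  change siteProj k (weyl (fun _ => z) (siteEmbed k g)) t = _
  rw [h1, h2, h3]
  rfl

theorem weyl_tensor_siteWeyl (z : Fin (n + 1) → Fin k → ℂ) (f : Hilb k n) (g : Site k) :
    weyl z (tensor f g) =
      tensor (weyl (fun i => z i.castSucc) f) (siteWeyl (z (Fin.last n)) g) :=
  weyl_tensor z f g _ (siteWeyl_coeFn _ g)

end Weyl

/-! ### Test functions -/

section TestFunctions

open ContinuousLinearMap Filter Topology
open scoped ContDiff ComplexConjugate

variable {k n : ℕ}

/-- The complex valued smooth functions of compact support. -/
def testSubmodule (k n : ℕ) : Submodule ℂ (Config k n → ℂ) where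
  carrier := {φ | ContDiff ℝ ∞ φ ∧ HasCompactSupport φ}
  zero_mem' := ⟨contDiff_const, HasCompactSupport.zero⟩
  add_mem' h h' := ⟨h.1.add h'.1, h.2.add h'.2⟩
  smul_mem' _ _ h := ⟨contDiff_const.mul h.1, h.2.mul_left⟩

/-- The type of complex valued smooth functions of compact support. -/
abbrev TestFun (k n : ℕ) : Type := testSubmodule k n

theorem TestFun.contDiff (φ : TestFun k n) : ContDiff ℝ ∞ φ.1 := φ.2.1

theorem TestFun.hasCompactSupport (φ : TestFun k n) : HasCompactSupport φ.1 := φ.2.2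

theorem TestFun.differentiable (φ : TestFun k n) : Differentiable ℝ φ.1 :=
  φ.contDiff.differentiable (by simp)

theorem TestFun.memLp (φ : TestFun k n) : MemLp φ.1 2 (volume : Measure (Config k n)) :=
  φ.contDiff.continuous.memLp_of_hasCompactSupport φ.hasCompactSupport

/-- Test functions as vectors. -/
def testIncl (k n : ℕ) : TestFun k n →ₗ[ℂ] Hilb k n where
  toFun φ := φ.memLp.toLp _
  map_add' φ ψ := MemLp.toLp_add φ.memLp ψ.memLp
  map_smul' c φ := MemLp.toLp_const_smul c φ.memLp

theorem testIncl_coeFn (φ : TestFun k n) : testIncl k n φ =ᵐ[volume] φ.1 :=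
  φ.memLp.coeFn_toLp

theorem inner_testIncl (φ : TestFun k n) (v : Hilb k n) :
    ⟪testIncl k n φ, v⟫_ℂ = ∫ x, conj (φ.1 x) * v x := by
  rw [L2.inner_def]
  refine integral_congr_ae ?_
  filter_upwards [testIncl_coeFn φ] with x hx
  rw [hx, RCLike.inner_apply, mul_comm]

/-- A real valued test function as a complex valued one. -/
def TestFun.ofReal {φ : Config k n → ℝ} (hφ : ContDiff ℝ ∞ φ) (hs : HasCompactSupport φ) :
    TestFun k n :=
  ⟨fun x => (φ x : ℂ), Complex.ofRealCLM.contDiff.comp hφ,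
    hs.comp_left (g := Complex.ofReal) Complex.ofReal_zero⟩

theorem inner_testIncl_ofReal {φ : Config k n → ℝ} (hφ : ContDiff ℝ ∞ φ)
    (hs : HasCompactSupport φ) (v : Hilb k n) :
    ⟪testIncl k n (TestFun.ofReal hφ hs), v⟫_ℂ = ∫ x, φ x • v x := by
  rw [inner_testIncl]
  refine integral_congr_ae (Eventually.of_forall fun x => ?_)
  simp [TestFun.ofReal]

theorem denseRange_testIncl : DenseRange (testIncl k n) := by
  have h : (LinearMap.range (testIncl k n)).topologicalClosure = ⊤ := by
    rw [Submodule.topologicalClosure_eq_top_iff, Submodule.eq_bot_iff]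
    intro v hv
    have key : ∀ᵐ x ∂(volume : Measure (Config k n)), v x = 0 := by
      refine ae_eq_zero_of_integral_contDiff_smul_eq_zero (locallyIntegrable v) fun φ hφ hs => ?_
      rw [← inner_testIncl_ofReal hφ hs]
      exact (Submodule.mem_orthogonal _ _).1 hv _ ⟨_, rfl⟩
    apply Lp.ext
    filter_upwards [key, Lp.coeFn_zero ℂ 2 (volume : Measure (Config k n))] with x h1 h2
    simp [h1]
  intro v
  have hv : v ∈ (LinearMap.range (testIncl k n)).topologicalClosure := h ▸ Submodule.mem_top
  exact hv

/-- Multiplication of test functions by a coordinate. -/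
def posOp (i : Fin n) (j : Fin k) : TestFun k n →ₗ[ℂ] TestFun k n where
  toFun φ := ⟨fun x => (x i j : ℂ) * φ.1 x, by
    have := φ.contDiff
    exact ContDiff.mul (Complex.ofRealCLM.contDiff.comp (by fun_prop)) this,
    φ.hasCompactSupport.mul_left⟩
  map_add' φ ψ := Subtype.ext <| funext fun x => mul_add _ _ _
  map_smul' c φ := Subtype.ext <| funext fun x => mul_left_comm _ _ _

/-- `-ı` times a partial derivative of test functions. -/
def momOp (i : Fin n) (j : Fin k) : TestFun k n →ₗ[ℂ] TestFun k n where
  toFun φ := ⟨fun x => -Complex.I * fderiv ℝ φ.1 x (dir i j), by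
    have h : ContDiff ℝ ∞ fun x => fderiv ℝ φ.1 x (dir i j) :=
      (φ.contDiff.fderiv_right (m := ∞) (by simp)).clm_apply contDiff_const
    exact contDiff_const.mul h,
    (φ.hasCompactSupport.fderiv_apply (𝕜 := ℝ) (dir i j)).mul_left⟩
  map_add' φ ψ := Subtype.ext <| funext fun x => by
    change -Complex.I * fderiv ℝ (φ.1 + ψ.1) x (dir i j) = _
    rw [fderiv_add (φ.differentiable x) (ψ.differentiable x)]
    exact mul_add _ _ _
  map_smul' c φ := Subtype.ext <| funext fun x => by
    change -Complex.I * fderiv ℝ (c • φ.1) x (dir i j) = _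
    rw [fderiv_const_smul (φ.differentiable x)]
    exact mul_left_comm _ _ _

theorem continuous_coord (i : Fin n) (j : Fin k) :
    Continuous fun x : Config k n => (x i j : ℂ) := by
  fun_prop

/-- For the converse, `x v` is only known to be locally integrable, which suffices for test
functions to identify it with `w`. -/
theorem isAdjointOf_position (i : Fin n) (j : Fin k) :
    IsAdjointOf (position i j) (testIncl k n) (posOp i j) := by
  intro v w
  rw [position_graph]
  constructor
  · intro h φ
    have h' : w =ᵐ[volume] fun x => (x i j : ℂ) * v x := h
    rw [inner_testIncl, inner_testIncl]
    refine integral_congr_ae ?_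
    filter_upwards [h'] with x hx
    rw [hx]
    simp only [posOp, LinearMap.coe_mk, AddHom.coe_mk, map_mul, Complex.conj_ofReal]
    ring
  · intro h
    change w =ᵐ[volume] fun x => (x i j : ℂ) * v x
    have hl : LocallyIntegrable (fun x => (x i j : ℂ) * v x) volume := by
      have h1 := ((locallyIntegrable v).locallyIntegrableOn Set.univ).continuousOn_mul
        (continuous_coord i j).continuousOn isOpen_univ.isLocallyClosed
      exact locallyIntegrableOn_univ.1 h1
    refine ae_eq_of_integral_contDiff_smul_eq (locallyIntegrable w) hl fun φ hφ hs => ?_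
    rw [← inner_testIncl_ofReal hφ hs, ← h, inner_testIncl]
    refine integral_congr_ae (Eventually.of_forall fun x => ?_)
    simp only [posOp, TestFun.ofReal, LinearMap.coe_mk, AddHom.coe_mk, map_mul,
      Complex.conj_ofReal, Complex.real_smul]
    ring

theorem fderiv_ofReal_apply {φ : Config k n → ℝ} (hφ : ContDiff ℝ ∞ φ) (x v : Config k n) :
    fderiv ℝ (fun y => (φ y : ℂ)) x v = (fderiv ℝ φ x v : ℂ) := by
  have h := (Complex.ofRealCLM.hasFDerivAt (x := φ x)).comp x
    ((hφ.differentiable (by simp)) x).hasFDerivAt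
  have h2 : HasFDerivAt (fun y => (φ y : ℂ)) (Complex.ofRealCLM ∘L fderiv ℝ φ x) x := h
  rw [h2.fderiv]
  rfl

theorem TestFun.fderiv_re (φ : TestFun k n) (x v : Config k n) :
    fderiv ℝ (fun y => (φ.1 y).re) x v = (fderiv ℝ φ.1 x v).re := by
  have h : HasFDerivAt (fun y => (φ.1 y).re) (Complex.reCLM ∘L fderiv ℝ φ.1 x) x :=
    (Complex.reCLM.hasFDerivAt (x := φ.1 x)).comp x (φ.differentiable x).hasFDerivAt
  rw [h.fderiv]
  rfl

theorem TestFun.fderiv_im (φ : TestFun k n) (x v : Config k n) :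
    fderiv ℝ (fun y => (φ.1 y).im) x v = (fderiv ℝ φ.1 x v).im := by
  have h : HasFDerivAt (fun y => (φ.1 y).im) (Complex.imCLM ∘L fderiv ℝ φ.1 x) x :=
    (Complex.imCLM.hasFDerivAt (x := φ.1 x)).comp x (φ.differentiable x).hasFDerivAt
  rw [h.fderiv]
  rfl

/-- Weak derivatives are tested against real functions and adjoints against complex ones, so `φ` is
split into real and imaginary parts. -/
theorem isAdjointOf_momentum (i : Fin n) (j : Fin k) :
    IsAdjointOf (momentum i j) (testIncl k n) (momOp i j) := by
  intro v w
  rw [momentum_graph]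
  constructor
  · intro h φ
    have hr : ContDiff ℝ ∞ fun x => (φ.1 x).re := Complex.reCLM.contDiff.comp φ.contDiff
    have hi : ContDiff ℝ ∞ fun x => (φ.1 x).im := Complex.imCLM.contDiff.comp φ.contDiff
    have hrs : HasCompactSupport fun x => (φ.1 x).re :=
      φ.hasCompactSupport.comp_left (g := Complex.re) Complex.zero_re
    have his : HasCompactSupport fun x => (φ.1 x).im :=
      φ.hasCompactSupport.comp_left (g := Complex.im) Complex.zero_im
    have h1 := h _ hr hrs
    have h2 := h _ hi his
    simp only at h1 h2
    have e1 : ∫ x, conj ((momOp i j φ).1 x) * v x =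
        ∫ x, (Complex.I * (fderiv ℝ (fun y => (φ.1 y).re) x (dir i j) • v x) +
          fderiv ℝ (fun y => (φ.1 y).im) x (dir i j) • v x) := by
      refine integral_congr_ae (Eventually.of_forall fun x => ?_)
      simp only [TestFun.fderiv_re, TestFun.fderiv_im, momOp, LinearMap.coe_mk, AddHom.coe_mk,
        Complex.real_smul]
      conv_lhs => rw [← Complex.re_add_im (fderiv ℝ φ.1 x (dir i j))]
      simp only [map_mul, map_neg, map_add, Complex.conj_I, Complex.conj_ofReal]
      linear_combination (-(((fderiv ℝ φ.1 x) (dir i j)).im : ℂ) * v x) * Complex.I_sq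
    have e2 : ∫ x, conj (φ.1 x) * w x =
        ∫ x, (-Complex.I * ((φ.1 x).re • (Complex.I * w x)) -
          (φ.1 x).im • (Complex.I * w x)) := by
      refine integral_congr_ae (Eventually.of_forall fun x => ?_)
      simp only [Complex.real_smul]
      conv_lhs => rw [← Complex.re_add_im (φ.1 x)]
      simp only [map_mul, map_add, Complex.conj_I, Complex.conj_ofReal]
      linear_combination (((φ.1 x).re : ℂ) * w x) * Complex.I_sq
    have hw : ∀ {f : Config k n → ℝ}, Continuous f → HasCompactSupport f →
        Integrable (fun x => f x • (Complex.I * w x)) volume := by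
      intro f hf hfs
      simpa only [mul_smul_comm] using (integrable_test w hf hfs).const_mul Complex.I
    rw [inner_testIncl, inner_testIncl, e1, e2,
      integral_add ((integrable_fderiv_test v _ hr hrs).const_mul _)
        (integrable_fderiv_test v _ hi his),
      integral_sub ((hw hr.continuous hrs).const_mul _) (hw hi.continuous his),
      integral_const_mul, integral_const_mul, h1, h2]
    ring
  · intro h φ hφ hs
    have h1 := h (TestFun.ofReal hφ hs)
    rw [inner_testIncl_ofReal, inner_testIncl] at h1
    have e1 : ∫ x, conj ((momOp i j (TestFun.ofReal hφ hs)).1 x) * v x =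
        Complex.I * ∫ x, fderiv ℝ φ x (dir i j) • v x := by
      rw [← integral_const_mul]
      refine integral_congr_ae (Eventually.of_forall fun x => ?_)
      simp only [momOp, TestFun.ofReal, LinearMap.coe_mk, AddHom.coe_mk, fderiv_ofReal_apply hφ,
        map_mul, map_neg, Complex.conj_I, Complex.conj_ofReal, Complex.real_smul]
      ring
    simp only [← mul_smul_comm]
    rw [integral_const_mul, ← h1, e1]
    linear_combination (∫ x, fderiv ℝ φ x (dir i j) • v x) * Complex.I_sq

/-- The Weyl operators on test functions. -/
def weylTest (z : Fin n → Fin k → ℂ) (φ : TestFun k n) : TestFun k n :=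
  ⟨fun x => Complex.exp (Complex.I * (weylPhase z x : ℂ)) * φ.1 (x - weylShift z), by
    have h1 : ContDiff ℝ ∞ (weylPhase z) := by
      unfold weylPhase
      fun_prop
    have h2 : ContDiff ℝ ∞ fun x : Config k n => φ.1 (x - weylShift z) :=
      φ.contDiff.comp (contDiff_id.sub contDiff_const)
    exact (contDiff_const.mul (Complex.ofRealCLM.contDiff.comp h1)).cexp.mul h2, by
    refine HasCompactSupport.mul_left ?_
    exact φ.hasCompactSupport.comp_homeomorph (Homeomorph.subRight (weylShift z))⟩

theorem testIncl_weylTest (z : Fin n → Fin k → ℂ) (φ : TestFun k n) :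
    testIncl k n (weylTest z φ) = weyl z (testIncl k n φ) := by
  apply Lp.ext
  have hp := measurePreserving_sub_right (volume : Measure (Config k n)) (weylShift z)
  filter_upwards [testIncl_coeFn (weylTest z φ), weyl_coeFn z (testIncl k n φ),
    hp.quasiMeasurePreserving.ae_eq_comp (testIncl_coeFn φ)] with x h1 h2 h3
  simp only [Function.comp_apply] at h3
  rw [h1, h2, h3]
  rfl

theorem weylTest_posOp (z : Fin n → Fin k → ℂ) (i : Fin n) (j : Fin k) (φ : TestFun k n) :
    weylTest z (posOp i j φ) = posOp i j (weylTest z φ) - ((√2 * (z i j).re : ℝ) : ℂ) •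
      weylTest z φ := by
  refine Subtype.ext (funext fun x => ?_)
  change Complex.exp (Complex.I * (weylPhase z x : ℂ)) *
      (((x - weylShift z) i j : ℝ) * φ.1 (x - weylShift z)) =
    (x i j : ℂ) * (Complex.exp (Complex.I * (weylPhase z x : ℂ)) * φ.1 (x - weylShift z)) -
      ((√2 * (z i j).re : ℝ) : ℂ) *
        (Complex.exp (Complex.I * (weylPhase z x : ℂ)) * φ.1 (x - weylShift z))
  simp only [Pi.sub_apply, weylShift, Complex.ofReal_sub]
  ring

theorem fderiv_weylPhase_dir (z : Fin n → Fin k → ℂ) (i : Fin n) (j : Fin k) (x : Config k n) :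
    HasFDerivAt (weylPhase z) (fderiv ℝ (weylPhase z) x) x ∧
      fderiv ℝ (weylPhase z) x (dir i j) = √2 * (z i j).im := by
  let L : Config k n →L[ℝ] ℝ := ∑ a, ∑ b, (√2 * (z a b).im) •
    ((ContinuousLinearMap.proj b : (Fin k → ℝ) →L[ℝ] ℝ) ∘L
      (ContinuousLinearMap.proj a : Config k n →L[ℝ] (Fin k → ℝ)))
  have hL : weylPhase z = fun x => L x - ∑ a, ∑ b, (z a b).re * (z a b).im := by
    funext x
    simp [L, weylPhase, Finset.sum_sub_distrib]
  have h : HasFDerivAt (weylPhase z) L x := by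
    rw [hL]
    exact L.hasFDerivAt.sub_const _
  rw [h.fderiv]
  refine ⟨h, ?_⟩
  simp [L, dir, Pi.single_apply, ite_apply]

/-- By the product rule the shift is the derivative of the phase, `√2 Im z`; for position it comes
from the translation. -/
theorem weylTest_momOp (z : Fin n → Fin k → ℂ) (i : Fin n) (j : Fin k) (φ : TestFun k n) :
    weylTest z (momOp i j φ) = momOp i j (weylTest z φ) - ((√2 * (z i j).im : ℝ) : ℂ) •
      weylTest z φ := by
  refine Subtype.ext (funext fun x => ?_)
  obtain ⟨h1, h2⟩ := fderiv_weylPhase_dir z i j x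
  have h3 : HasFDerivAt (fun y => Complex.exp (Complex.I * (weylPhase z y : ℂ)))
      (Complex.exp (Complex.I * (weylPhase z x : ℂ)) •
        (Complex.I • (Complex.ofRealCLM ∘L fderiv ℝ (weylPhase z) x))) x :=
    (((Complex.ofRealCLM.hasFDerivAt (x := weylPhase z x)).comp x h1).const_mul Complex.I).cexp
  have h4 : HasFDerivAt (fun y => φ.1 (y - weylShift z)) (fderiv ℝ φ.1 (x - weylShift z)) x := by
    have := (φ.differentiable (x - weylShift z)).hasFDerivAt.comp x
      ((hasFDerivAt_id x).sub_const (weylShift z))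
    simpa using! this
  have h5 := (h3.mul h4).fderiv
  change Complex.exp (Complex.I * (weylPhase z x : ℂ)) *
      (-Complex.I * fderiv ℝ φ.1 (x - weylShift z) (dir i j)) =
    -Complex.I * fderiv ℝ ((fun y => Complex.exp (Complex.I * (weylPhase z y : ℂ))) *
        fun y => φ.1 (y - weylShift z)) x (dir i j) -
      ((√2 * (z i j).im : ℝ) : ℂ) *
        (Complex.exp (Complex.I * (weylPhase z x : ℂ)) * φ.1 (x - weylShift z))
  rw [h5]
  simp only [add_apply, smul_apply, smul_eq_mul, comp_apply, Complex.ofRealCLM_apply, h2]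
  linear_combination (Complex.exp (Complex.I * (weylPhase z x : ℂ)) * φ.1 (x - weylShift z) *
    ((√2 * (z i j).im : ℝ) : ℂ)) * Complex.I_sq

/-- The canonical observables on test functions. -/
def testObs (i : Fin n) (r : Idx k) : TestFun k n →ₗ[ℂ] TestFun k n :=
  if r.2 = 0 then posOp i r.1 else momOp i r.1

theorem isAdjointOf_canonicalObs (i : Fin n) (r : Idx k) :
    IsAdjointOf (canonicalObs i r) (testIncl k n) (testObs i r) := by
  unfold canonicalObs testObs
  split_ifs
  · exact isAdjointOf_position i r.1
  · exact isAdjointOf_momentum i r.1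

end TestFunctions

/-- The factor `2^{-1/2}` in the amplitude cancels the `√2` of the Weyl shifts, so the shift is
exactly the component of `γ`. -/
theorem weylTest_testObs_amplitude {D Ω : Type*} {k n : ℕ} (γ : D → Idx k → Ω → ℝ) (a : Fin n ↪ D) (ω : Ω)
    (i : Fin n) (r : Idx k) (φ : TestFun k n) :
    weylTest (amplitude γ a ω) (testObs i r φ) = testObs i r (weylTest (amplitude γ a ω) φ) -
      (γ (a i) r ω : ℂ) • weylTest (amplitude γ a ω) φ := by
  have hre : √2 * (amplitude γ a ω i r.1).re = γ (a i) (r.1, 0) ω := by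
    simp [amplitude, ← Complex.ofReal_inv]
  have him : √2 * (amplitude γ a ω i r.1).im = γ (a i) (r.1, 1) ω := by
    simp [amplitude, ← Complex.ofReal_inv]
  obtain ⟨j, s⟩ := r
  unfold testObs
  fin_cases s
  · simpa [← hre] using! weylTest_posOp (amplitude γ a ω) i j φ
  · simpa [← him] using! weylTest_momOp (amplitude γ a ω) i j φ

/-! ### The randomly displaced process -/

section AverageState

open ContinuousLinearMap Filter Topology

instance fact_two_ne_top : Fact ((2 : ENNReal) ≠ ⊤) := ⟨ENNReal.ofNat_ne_top⟩

variable {D Ω : Type*} {k n : ℕ} [MeasurableSpace Ω] {P : Measure Ω} {γ : D → Idx k → Ω → ℝ}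

theorem aestronglyMeasurable_amplitude (hγ : ∀ a r, MemLp (γ a r) 2 P) (a : Fin n ↪ D) :
    AEStronglyMeasurable (amplitude γ a) P := by
  refine AEMeasurable.aestronglyMeasurable ?_
  refine aemeasurable_pi_lambda _ fun i => aemeasurable_pi_lambda _ fun j => ?_
  have h0 := (hγ (a i) (j, 0)).1.aemeasurable
  have h1 := (hγ (a i) (j, 1)).1.aemeasurable
  unfold amplitude
  fun_prop

theorem displacedState_apply (ρ : QuantumProcess D k) (a : Fin n ↪ D) (ω : Ω) (g : Hilb k n) :
    displacedState ρ γ a ω g =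
      adjoint (weyl (amplitude γ a ω)) (ρ.state a (weyl (amplitude γ a ω) g)) := by
  simp [displacedState, randomUnitary]

theorem inner_displacedState (ρ : QuantumProcess D k) (a : Fin n ↪ D) (ω : Ω) (f g : Hilb k n) :
    ⟪f, displacedState ρ γ a ω g⟫_ℂ =
      ⟪weyl (amplitude γ a ω) f, ρ.state a (weyl (amplitude γ a ω) g)⟫_ℂ := by
  rw [displacedState_apply, adjoint_inner_right]

/-- The conjugated state is `A A†` with `A = W(-z) √T`, and `A` is norm continuous in `z` because
`√T` is Hilbert-Schmidt. -/
theorem continuous_adjoint_weyl_comp {T : Hilb k n →L[ℂ] Hilb k n} (hT : IsDensity T) :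
    Continuous fun z : Fin n → Fin k → ℂ => adjoint (weyl z) ∘L T ∘L weyl z := by
  have h : Continuous fun z : Fin n → Fin k → ℂ => weyl (-z) ∘L root T :=
    hT.hsPair.isHS.continuous_comp (fun z f => norm_weyl (-z) f)
      fun f => (continuous_weyl f).comp continuous_neg
  have h2 : Continuous fun z : Fin n → Fin k → ℂ =>
      (weyl (-z) ∘L root T) ∘L adjoint (weyl (-z) ∘L root T) :=
    h.clm_comp ((adjoint (𝕜 := ℂ) (E := Hilb k n) (F := Hilb k n)).continuous.comp h)
  convert h2 using 2 with z
  conv_lhs => rw [← root_comp_root hT.1]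
  rw [adjoint_comp, adjoint_weyl, adjoint_weyl, neg_neg, adjoint_root]
  rfl

theorem integrable_displacedState [IsFiniteMeasure P] (hγ : ∀ a r, MemLp (γ a r) 2 P)
    (ρ : QuantumProcess D k) (a : Fin n ↪ D) : Integrable (displacedState ρ γ a) P := by
  have hm : AEStronglyMeasurable (displacedState ρ γ a) P := by
    have h := (continuous_adjoint_weyl_comp (ρ.isDensity a)).comp_aestronglyMeasurable
      (aestronglyMeasurable_amplitude hγ a)
    have e : displacedState ρ γ a = fun ω => adjoint (weyl (amplitude γ a ω)) ∘L ρ.state a ∘L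
        weyl (amplitude γ a ω) := by
      funext ω
      rw [displacedState, randomUnitary, adjoint_adjoint]
    rw [e]
    exact h
  refine Integrable.of_bound hm ‖ρ.state a‖ (Eventually.of_forall fun ω => ?_)
  refine opNorm_le_bound _ (norm_nonneg _) fun f => ?_
  rw [displacedState_apply, adjoint_weyl, norm_weyl]
  refine (le_opNorm _ _).trans_eq ?_
  rw [norm_weyl]

/-- The average of the displaced states. -/
def averageState (ρ : QuantumProcess D k) (γ : D → Idx k → Ω → ℝ) (P : Measure Ω)
    (a : Fin n ↪ D) : Hilb k n →L[ℂ] Hilb k n :=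
  ∫ ω, displacedState ρ γ a ω ∂P

theorem inner_averageState [IsFiniteMeasure P] (hγ : ∀ a r, MemLp (γ a r) 2 P)
    (ρ : QuantumProcess D k) (a : Fin n ↪ D) (f g : Hilb k n) :
    ⟪f, averageState ρ γ P a g⟫_ℂ =
      ∫ ω, ⟪weyl (amplitude γ a ω) f, ρ.state a (weyl (amplitude γ a ω) g)⟫_ℂ ∂P := by
  have h := integrable_displacedState hγ ρ a
  rw [averageState, ContinuousLinearMap.integral_apply h,
    ← integral_inner (h.apply_continuousLinearMap g)]
  simp only [inner_displacedState]

theorem integrable_inner_weyl [IsFiniteMeasure P] (hγ : ∀ a r, MemLp (γ a r) 2 P)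
    (ρ : QuantumProcess D k) (a : Fin n ↪ D) (f g : Hilb k n) : Integrable (fun ω =>
      ⟪weyl (amplitude γ a ω) f, ρ.state a (weyl (amplitude γ a ω) g)⟫_ℂ) P := by
  simpa only [inner_displacedState] using
    ((integrable_displacedState hγ ρ a).apply_continuousLinearMap g).const_inner (𝕜 := ℂ) f

theorem averageState_isPositive [IsFiniteMeasure P] (hγ : ∀ a r, MemLp (γ a r) 2 P)
    (ρ : QuantumProcess D k) (a : Fin n ↪ D) : (averageState ρ γ P a).IsPositive := by
  rw [isPositive_iff_complex]
  intro f
  have h : ⟪averageState ρ γ P a f, f⟫_ℂ =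
      ((∫ ω, ‖root (ρ.state a) (weyl (amplitude γ a ω) f)‖ ^ 2 ∂P : ℝ) : ℂ) := by
    rw [← inner_conj_symm, inner_averageState hγ]
    simp only [← inner_root_root (ρ.isDensity a).1, inner_self_eq_norm_sq_to_K]
    rw [← integral_complex_ofReal, ← integral_conj]
    congr 1
    funext ω
    simp
  rw [h]
  refine ⟨by simp, ?_⟩
  rw [RCLike.re_to_complex, Complex.ofReal_re]
  exact integral_nonneg fun ω => sq_nonneg _

/-- The random displacement of the state of finitely many sites. -/
def displacement [IsFiniteMeasure P] (hγ : ∀ a r, MemLp (γ a r) 2 P) (ρ : QuantumProcess D k)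
    (a : Fin n ↪ D) : Displacement P (TestFun k n) (ρ.state a) (averageState ρ γ P a) where
  W ω := weylEquiv (amplitude γ a ω)
  meas f := (continuous_weyl f).comp_aestronglyMeasurable (aestronglyMeasurable_amplitude hγ a)
  incl := testIncl k n
  dense := denseRange_testIncl
  act ω := weylTest (amplitude γ a ω)
  incl_act _ φ := testIncl_weylTest _ φ
  density := ρ.isDensity a
  pos := averageState_isPositive hγ ρ a
  mix f g := inner_averageState hγ ρ a f g

theorem averageState_isDensity [IsProbabilityMeasure P] (hγ : ∀ a r, MemLp (γ a r) 2 P)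
    (ρ : QuantumProcess D k) (a : Fin n ↪ D) : IsDensity (averageState ρ γ P a) := by
  refine ⟨averageState_isPositive hγ ρ a, fun ι e => ?_⟩
  let S := displacement hγ ρ a
  -- The trace is the second moment of the identity observable.
  have h := S.one.hsPair_mixed S.one S.density.hsPair ι e
  simp only [Displacement.Observable.mixed_one,
    inner_root_root (averageState_isPositive hγ ρ a)] at h
  simpa [Displacement.one] using h

theorem averageState_perm [IsFiniteMeasure P] (hγ : ∀ a r, MemLp (γ a r) 2 P)
    (ρ : QuantumProcess D k) (a : Fin n ↪ D) (π : Equiv.Perm (Fin n)) :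
    averageState ρ γ P (π.toEmbedding.trans a) =
      permOp k π ∘L averageState ρ γ P a ∘L permOp k π.symm := by
  refine ContinuousLinearMap.ext fun g => ext_inner_left ℂ fun f => ?_
  have hadj : adjoint (permOp k π.symm) = permOp k π := by rw [adjoint_permOp, Equiv.symm_symm]
  have hw : ∀ ω f, permOp k π.symm (weyl (amplitude γ (π.toEmbedding.trans a) ω) f) =
      weyl (amplitude γ a ω) (permOp k π.symm f) := by
    intro ω f
    rw [permOp_weyl]
    congr 2
    funext i j
    simp [amplitude]
  rw [comp_apply, comp_apply, ← hadj, adjoint_inner_right, inner_averageState hγ,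
    inner_averageState hγ]
  refine integral_congr_ae (Eventually.of_forall fun ω => ?_)
  simp only [ρ.perm, comp_apply]
  rw [← hadj, adjoint_inner_right, hw, hw]

/-- Dominates the off-diagonal terms in the marginal condition by diagonal ones, whose sums the same
condition computes. -/
theorem norm_inner_le_root {H : Type} [NormedAddCommGroup H] [InnerProductSpace ℂ H]
    [CompleteSpace H] {T : H →L[ℂ] H} (hT : T.IsPositive) (f g : H) :
    ‖⟪f, T g⟫_ℂ‖ ≤ (⟪f, T f⟫_ℂ).re + (⟪g, T g⟫_ℂ).re := by
  have h : ∀ f, (⟪f, T f⟫_ℂ).re = ‖root T f‖ ^ 2 := by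
    intro f
    rw [← inner_root_root hT, inner_self_eq_norm_sq_to_K]
    norm_cast
  rw [h, h, ← inner_root_root hT]
  refine (norm_inner_le_norm _ _).trans ?_
  nlinarith [sq_nonneg (‖root T f‖ - ‖root T g‖), sq_nonneg ‖root T f‖, sq_nonneg ‖root T g‖]

theorem averageState_marginal [IsFiniteMeasure P] (hγ : ∀ a r, MemLp (γ a r) 2 P)
    (ρ : QuantumProcess D k) (a : Fin (n + 1) ↪ D) :
    IsMarginal (averageState ρ γ P a) (averageState ρ γ P (Fin.castSuccEmb.trans a)) := by
  intro f g ι e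
  have := countable_of_hilbertBasis e
  have key : ∀ ω (f g : Hilb k n), HasSum (fun i => ⟪weyl (amplitude γ a ω) (tensor f (e i)),
      ρ.state a (weyl (amplitude γ a ω) (tensor g (e i)))⟫_ℂ)
      ⟪weyl (amplitude γ (Fin.castSuccEmb.trans a) ω) f, ρ.state (Fin.castSuccEmb.trans a)
        (weyl (amplitude γ (Fin.castSuccEmb.trans a) ω) g)⟫_ℂ := by
    intro ω f g
    -- The Weyl operator splits off its last factor, which merely replaces `e` by another basis of
    -- that factor.
    have h := ρ.marginal a (weyl (amplitude γ (Fin.castSuccEmb.trans a) ω) f)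
      (weyl (amplitude γ (Fin.castSuccEmb.trans a) ω) g) ι
      (mapBasis e (siteWeyl (amplitude γ a ω (Fin.last n))))
    simpa only [mapBasis_apply, weyl_tensor_siteWeyl] using! h
  have hre : ∀ ω, HasSum (fun i =>
      (⟪weyl (amplitude γ a ω) (tensor f (e i)),
        ρ.state a (weyl (amplitude γ a ω) (tensor f (e i)))⟫_ℂ).re +
      (⟪weyl (amplitude γ a ω) (tensor g (e i)),
        ρ.state a (weyl (amplitude γ a ω) (tensor g (e i)))⟫_ℂ).re) _ := fun ω =>
    (Complex.hasSum_re (key ω f f)).add (Complex.hasSum_re (key ω g g))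
  simp only [inner_averageState hγ]
  refine hasSum_integral_of_dominated_convergence _
    (fun i => (integrable_inner_weyl hγ ρ a _ _).1)
    (fun i => Eventually.of_forall fun ω => norm_inner_le_root (ρ.isDensity a).1 _ _)
    (Eventually.of_forall fun ω => (hre ω).summable) ?_
    (Eventually.of_forall fun ω => key ω f g)
  simp only [(hre _).tsum_eq]
  exact (integrable_inner_weyl hγ ρ _ f f).re.add (integrable_inner_weyl hγ ρ _ g g).re

/-- The randomly displaced process. -/
def averageProcess [IsProbabilityMeasure P] (hγ : ∀ a r, MemLp (γ a r) 2 P)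
    (ρ : QuantumProcess D k) : QuantumProcess D k where
  state a := averageState ρ γ P a
  isDensity a := averageState_isDensity hγ ρ a
  perm a π := averageState_perm hγ ρ a π
  marginal a := averageState_marginal hγ ρ a

theorem exists_observable [IsFiniteMeasure P] (hγ : ∀ a r, MemLp (γ a r) 2 P)
    (hmean : ∀ a r, ∫ ω, γ a r ω ∂P = 0) {ρ : QuantumProcess D k} (hρ : ρ.FiniteSecondMoments)
    (a : Fin n ↪ D) (i : Fin n) (r : Idx k) :
    ∃ x : (displacement hγ ρ a).Observable, x.c = γ (a i) r ∧
      IsAdjointOf (canonicalObs i r) (displacement hγ ρ a).incl x.op := by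
  obtain ⟨B, hB, hs⟩ := (isAdjointOf_canonicalObs i r).exists_root_op (hρ a i r)
  refine ⟨⟨testObs i r, γ (a i) r, hγ _ _, hmean _ _, fun ω φ => ?_, B, hB, hs⟩, rfl,
    isAdjointOf_canonicalObs i r⟩
  change weyl (amplitude γ a ω) (testIncl k n (testObs i r φ)) =
    testIncl k n (testObs i r (weylTest (amplitude γ a ω) φ)) -
      (γ (a i) r ω : ℂ) • weyl (amplitude γ a ω) (testIncl k n φ)
  rw [← testIncl_weylTest, ← testIncl_weylTest, weylTest_testObs_amplitude, map_sub, map_smul]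

theorem averageProcess_hasCovarianceKernel [IsProbabilityMeasure P]
    (hγ : ∀ a r, MemLp (γ a r) 2 P) (hmean : ∀ a r, ∫ ω, γ a r ω ∂P = 0)
    {ρ : QuantumProcess D k} {K C : D → D → Matrix (Idx k) (Idx k) ℝ}
    (hK : ρ.HasCovarianceKernel K)
    (hC : ∀ a b r s, C a b r s = ∫ ω, γ a r ω * γ b s ω ∂P) :
    (averageProcess hγ ρ).HasCovarianceKernel (K + C) := by
  refine ⟨fun a i r => ?_, fun a i j r s => ?_⟩
  · obtain ⟨x, -, hx⟩ := exists_observable hγ hmean hK.1 a i r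
    exact hx.hasFiniteSecondMoment x
  · obtain ⟨x, hxc, hx⟩ := exists_observable hγ hmean hK.1 a i r
    obtain ⟨y, hyc, hy⟩ := exists_observable hγ hmean hK.1 a j s
    have h := hx.hasCovariance x y hy (hK.2 a i j r s)
    rw [hxc, hyc, ← hC] at h
    exact h

end AverageState

end KMode

end

theorem mainTheorem4 {D : Type*} [Countable D] {k : ℕ} (hk : 0 < k)
    (ρ : KMode.QuantumProcess D k) (K : D → D → Matrix (KMode.Idx k) (KMode.Idx k) ℝ)
    (hK : ρ.HasCovarianceKernel K)
    {Ω : Type*} [MeasurableSpace Ω] (P : MeasureTheory.Measure Ω)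
    [MeasureTheory.IsProbabilityMeasure P]
    (γ : D → KMode.Idx k → Ω → ℝ)
    (hγ : ∀ a r, MeasureTheory.MemLp (γ a r) 2 P)
    (hmean : ∀ a r, ∫ ω, γ a r ω ∂P = 0)
    (C : D → D → Matrix (KMode.Idx k) (KMode.Idx k) ℝ)
    (hC : ∀ a b r s, C a b r s = ∫ ω, γ a r ω * γ b s ω ∂P) :
    (∀ (n : ℕ) (a : Fin n ↪ D), MeasureTheory.Integrable (KMode.displacedState ρ γ a) P) ∧
    ∃ σ : KMode.QuantumProcess D k,
      (∀ (n : ℕ) (a : Fin n ↪ D), σ.state a = ∫ ω, KMode.displacedState ρ γ a ω ∂P) ∧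
      σ.HasCovarianceKernel (K + C) := by
  exact ⟨fun n a => KMode.integrable_displacedState hγ ρ a, KMode.averageProcess hγ ρ,
    fun n a => rfl, KMode.averageProcess_hasCovarianceKernel hγ hmean hK hC⟩
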